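/- **Conventions.** Let $(\mathcal V,\otimes,I,\ell,r)$ be a monoidal category whose set of objects is an element of a fixed universe $\mathrm{SET}$. A (left) $\mathcal V$-graded category $\mathcal C$ consists of objects, sets $\mathcal C(X;A,B)$ of graded morphisms $f:X,A\to B$ of grade $X\in\mathcal V$ (all in $\mathrm{SET}$), contravariantly functorial reindexings $\alpha^*$ along morphisms $\alpha$ of $\mathcal V$, composition $(g:Y,B\to C,\ f:X,A\to B)\mapsto g\circ f:Y\otimes X,A\to C$ and identities of grade $I$, natural, associative and unital up to reindexing along the structural isomorphisms of $\mathcal V$. With $\mathcal V$-graded functors and $\mathcal V$-graded natural transformations (families $\delta_A:I,FA\to GA$ with $(\ell_X^{-1})^*(\delta_B\circ Ff)=(r_X^{-1})^*(Gf\circ\delta_A)$ for all $f:X,A\to B$) they form a 2-category $\mathrm{LGCAT}_{\mathcal V}$; $\mathcal C_0$ denotes the category of graded morphisms of grade $I$. For an opmonoidal functor $F:\mathcal V\to\mathcal W$ and a $\mathcal W$-graded category $\mathcal C$, $F^*\mathcal C$ is the $\mathcal V$-graded category with the same objects and $(F^*\mathcal C)(X;A,B)=\mathcal C(FX;A,B)$.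 Write $U_\ell=(-,I):\mathcal V\to\mathcal V\times\mathcal W$ and $U_r=(I,-):\mathcal W\to\mathcal V\times\mathcal W$. A duoidal category $\mathrm V=(\mathcal V,\star)$ is a pseudomonoid $(\mathcal V,\star,J)$ in the 2-category of monoidal categories and opmonoidal functors; write $\xi:(Y\otimes X)\star(Y'\otimes X')\to(Y\star Y')\otimes(X\star X')$ and $\mu:I\star I\to I$ for the constraints of $\star$, and $\nu:J\to I$ for the counit of $J$. It is normal if $\nu$ is invertible; then there are canonical isomorphisms $\rho_X:X\star I\cong X\star J\cong X$ and $\lambda_X:I\star X\cong J\star X\cong X$, and canonical morphisms $$\sigma=(\rho_X\otimes\lambda_{X'})\cdot\xi\cdot(r_X^{-1}\star\ell_{X'}^{-1}):X\star X'\to X\otimes X',\qquad \tau=(\lambda_{X'}\otimes\rho_X)\cdot\xi\cdot(\ell_X^{-1}\star r_{X'}^{-1}):X\star X'\to X'\otimes X.$$ Given graded morphisms $f:X,A\to A'$, $g:X,B\to B'$, $\phi:X',A\to B$, $\phi':X',A'\to B'$ in a $\mathcal V$-graded category $\mathcal C$, $(f,g,\phi,\phi')$ is a $\mathrm V$-graded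 square if $\sigma^*(g\circ\phi)=\tau^*(\phi'\circ f)$. A $\mathrm V$-graded bifunctor $F:\mathcal A,\mathcal B\to\mathcal C$ consists of $\mathcal V$-graded functors $F(-,B):\mathcal A\to\mathcal C$ and $F(A,-):\mathcal B\to\mathcal C$ that agree on objects and such that $(F(f,B),F(f,B'),F(A,g),F(A',g))$ is a $\mathrm V$-graded square for all graded morphisms $f:X,A\to A'$ and $g:X',B\to B'$. With families $\theta_{AB}:F(A,B)\to G(A,B)$ in $\mathcal C_0$ that are graded natural in each variable separately, as morphisms, these form a category $\mathrm V\text{-}\mathsf{GBif}(\mathcal A,\mathcal B;\mathcal C)$, which is 2-functorial, contravariantly in $\mathcal A,\mathcal B$ and covariantly in $\mathcal C$: graded functors act by $F\mapsto RF(P-,Q-)$, and transformations $\pi:P\Rightarrow P'$, $\kappa:Q\Rightarrow Q'$, $\varrho:R\Rightarrow R'$ act by the composites $\varrho_{F(P'A,Q'B)}\cdot RF(P'A,\kappa_B)\cdot RF(\pi_A,QB)$. In a $(\mathcal V\times\mathcal W)$-graded category $\mathcal C$, a bigraded square is a quadruple $(f,g,\phi,\phi')$ with $f:A\to A'$, $g:B\to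 B'$ of grade $X$ in $U_\ell^*\mathcal C$ and $\phi:A\to B$, $\phi':A'\to B'$ of grade $X'$ in $U_r^*\mathcal C$ such that $(r_X^{-1},\ell_{X'}^{-1})^*(g\circ\phi)=(\ell_X^{-1},r_{X'}^{-1})^*(\phi'\circ f)$. For a $\mathcal V$-graded $\mathcal A$ and a $\mathcal W$-graded $\mathcal B$, the category $\mathsf{GBif}(\mathcal A,\mathcal B;\mathcal C)$ of graded bifunctors is defined as above, with graded functors $F(-,B):\mathcal A\to U_\ell^*\mathcal C$ and $F(A,-):\mathcal B\to U_r^*\mathcal C$ and bigraded squares in place of $\mathrm V$-graded squares; it is 2-functorial in the same way. The $\mathcal W$-graded category $[\mathcal A,\mathcal C]_r$ has as objects the $\mathcal V$-graded functors $F:\mathcal A\to U_\ell^*\mathcal C$ and as graded morphisms $X',F\to G$ the families $\phi_A:X',FA\to GA$ in $U_r^*\mathcal C$ such that all $(Ff,Gf,\phi_A,\phi_B)$ ($f:X,A\to B$ in $\mathcal A$) are bigraded squares; the $\mathcal V$-graded category $[\mathcal B,\mathcal C]_\ell$ has as objects the $\mathcal W$-graded functors $F:\mathcal B\to U_r^*\mathcal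 C$ and as graded morphisms $X,F\to G$ the families $\phi_B:X,FB\to GB$ in $U_\ell^*\mathcal C$ such that all $(\phi_B,\phi_{B'},Fg,Gg)$ ($g:X',B\to B'$ in $\mathcal B$) are bigraded squares. Both are 2-functorial, by pre- and postcomposition. For a $\mathcal V$-graded category $\mathcal C$, put $\mathcal C_\star=\star^*\mathcal C$, a $(\mathcal V\times\mathcal V)$-graded category; there are identity-on-objects isomorphisms $L:\mathcal C\cong U_\ell^*\mathcal C_\star$, $f\mapsto\rho_X^*f$, and $R:\mathcal C\cong U_r^*\mathcal C_\star$, $f\mapsto\lambda_X^*f$. **Theorem.** Let $\mathrm V=(\mathcal V,\star)$ be a normal duoidal category. 1. For $\mathcal V$-graded categories $\mathcal A,\mathcal B,\mathcal C$, composing the functors $F(-,B)$ with $L$ and the functors $F(A,-)$ with $R$ (and reindexing the components of transformations along $\mu$) defines an isomorphism of categories $\mathrm V\text{-}\mathsf{GBif}(\mathcal A,\mathcal B;\mathcal C)\cong\mathsf{GBif}(\mathcal A,\mathcal B;\mathcal C_\star)$, 2-natural in $\mathcal A,\mathcal B,\mathcal C$. In particular, graded bifunctors $\mathcal A,\mathcal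 B\to\mathcal C_\star$ correspond bijectively to $\mathrm V$-graded bifunctors $\mathcal A,\mathcal B\to\mathcal C$. 2. There are 2-functors $[-,?]_r,[-,?]_\ell:\mathrm{LGCAT}_{\mathcal V}^{\mathrm{op}}\times\mathrm{LGCAT}_{\mathcal V}\rightrightarrows\mathrm{LGCAT}_{\mathcal V}$ such that $$\mathrm{LGCAT}_{\mathcal V}(\mathcal A,[\mathcal B,\mathcal C]_\ell)\cong\mathrm V\text{-}\mathsf{GBif}(\mathcal A,\mathcal B;\mathcal C)\cong\mathrm{LGCAT}_{\mathcal V}(\mathcal B,[\mathcal A,\mathcal C]_r)$$ 2-naturally in $\mathcal A,\mathcal B,\mathcal C$. Explicitly, the objects of both $[\mathcal A,\mathcal C]_r$ and $[\mathcal A,\mathcal C]_\ell$ are the $\mathcal V$-graded functors $\mathcal A\to\mathcal C$, and a graded morphism $\phi:X',F\to G$ in $[\mathcal A,\mathcal C]_r$ (resp. $[\mathcal A,\mathcal C]_\ell$) is a family of graded morphisms $\phi_A:X',FA\to GA$ in $\mathcal C$ such that for every graded morphism $f:X,A\to B$ in $\mathcal A$, $(Ff,Gf,\phi_A,\phi_B)$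 (resp. $(\phi_A,\phi_B,Ff,Gf)$) is a $\mathrm V$-graded square; reindexing, composition and identities are those of $\mathcal C$, componentwise. Moreover $[\mathcal A,\mathcal C]_r\cong[\mathcal A,\mathcal C_\star]_r$ and $[\mathcal A,\mathcal C]_\ell\cong[\mathcal A,\mathcal C_\star]_\ell$, 2-naturally in $\mathcal A,\mathcal C$. -/

import Mathlib

open CategoryTheory MonoidalCategory Opposite

universe v u

set_option linter.unusedVariables false

namespace VGraded

section Basic

variable (V : Type u) [Category.{v} V] [MonoidalCategory V]

/-- A (left) `V`-graded category, in concrete form.  An element of `Hom X A B` is a graded morphism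
from `A` to `B` of grade `X`; `reindex α f` is the reindexing `α^*(f)`; `comp g f` is `g ∘ f`. -/
structure GradedCat where
  Obj : Type u
  Hom : V → Obj → Obj → Type u
  reindex : ∀ {X Y : V} {A B : Obj}, (Y ⟶ X) → Hom X A B → Hom Y A B
  comp : ∀ {X Y : V} {A B C : Obj}, Hom Y B C → Hom X A B → Hom (Y ⊗ X) A C
  ident : ∀ A : Obj, Hom (𝟙_ V) A A
  reindex_id : ∀ {X : V} {A B : Obj} (f : Hom X A B), reindex (𝟙 X) f = f
  reindex_comp : ∀ {X Y Z : V} {A B : Obj} (α : Z ⟶ Y) (β : Y ⟶ X) (f : Hom X A B),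
    reindex (α ≫ β) f = reindex α (reindex β f)
  comp_reindex : ∀ {X X' Y Y' : V} {A B C : Obj} (β : Y' ⟶ Y) (α : X' ⟶ X)
    (g : Hom Y B C) (f : Hom X A B),
    comp (reindex β g) (reindex α f) = reindex (β ⊗ₘ α) (comp g f)
  assoc : ∀ {X Y Z : V} {A B C D : Obj} (h : Hom Z C D) (g : Hom Y B C) (f : Hom X A B),
    comp (comp h g) f = reindex (α_ Z Y X).hom (comp h (comp g f))
  comp_ident : ∀ {X : V} {A B : Obj} (f : Hom X A B), comp f (ident A) = reindex (ρ_ X).hom f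
  ident_comp : ∀ {X : V} {A B : Obj} (f : Hom X A B), comp (ident B) f = reindex (λ_ X).hom f

variable {V}

/-- A `V`-graded functor. -/
@[ext]
structure GFunctor (C D : GradedCat V) where
  obj : C.Obj → D.Obj
  map : ∀ {X : V} {A B : C.Obj}, C.Hom X A B → D.Hom X (obj A) (obj B)
  map_reindex : ∀ {X Y : V} {A B : C.Obj} (α : Y ⟶ X) (f : C.Hom X A B),
    map (C.reindex α f) = D.reindex α (map f)
  map_comp : ∀ {X Y : V} {A B E : C.Obj} (g : C.Hom Y B E) (f : C.Hom X A B),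
    map (C.comp g f) = D.comp (map g) (map f)
  map_ident : ∀ A : C.Obj, map (C.ident A) = D.ident (obj A)

namespace GradedCat

variable (C : GradedCat V)

/-- For `f : X , A → B` and a morphism `δ : B → B'` of the underlying ordinary category,
the graded morphism `(ℓ_X⁻¹)^*(δ ∘ f) : X , A → B'`. -/
def lact {X : V} {A B B' : C.Obj} (δ : C.Hom (𝟙_ V) B B') (f : C.Hom X A B) : C.Hom X A B' :=
  C.reindex (λ_ X).inv (C.comp δ f)

/-- For `g : X , A → B` and a morphism `δ : A' → A` of the underlying ordinary category,
the graded morphism `(r_X⁻¹)^*(g ∘ δ) : X , A' → B`. -/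
def ract {X : V} {A' A B : C.Obj} (g : C.Hom X A B) (δ : C.Hom (𝟙_ V) A' A) : C.Hom X A' B :=
  C.reindex (ρ_ X).inv (C.comp g δ)

variable {C}

theorem reindex_reindex {X Y Z : V} {A B : C.Obj} (α : Z ⟶ Y) (β : Y ⟶ X) (f : C.Hom X A B) :
    C.reindex α (C.reindex β f) = C.reindex (α ≫ β) f := (C.reindex_comp _ _ _).symm

theorem comp_reindex_left {X Y Y' : V} {A B E : C.Obj} (β : Y' ⟶ Y)
    (g : C.Hom Y B E) (f : C.Hom X A B) :
    C.comp (C.reindex β g) f = C.reindex (β ▷ X) (C.comp g f) := by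
  have := C.comp_reindex β (𝟙 X) g f
  rwa [C.reindex_id, tensorHom_id] at this

theorem comp_reindex_right {X X' Y : V} {A B E : C.Obj} (α : X' ⟶ X)
    (g : C.Hom Y B E) (f : C.Hom X A B) :
    C.comp g (C.reindex α f) = C.reindex (Y ◁ α) (C.comp g f) := by
  have := C.comp_reindex (𝟙 Y) α g f
  rwa [C.reindex_id, id_tensorHom] at this

theorem assoc' {X Y Z : V} {A B E D : C.Obj} (h : C.Hom Z E D) (g : C.Hom Y B E)
    (f : C.Hom X A B) :
    C.comp h (C.comp g f) = C.reindex (α_ Z Y X).inv (C.comp (C.comp h g) f) := by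
  rw [C.assoc, reindex_reindex, Iso.inv_hom_id, C.reindex_id]

theorem lact_ident {X : V} {A B : C.Obj} (f : C.Hom X A B) : C.lact (C.ident B) f = f := by
  rw [lact, C.ident_comp, reindex_reindex, Iso.inv_hom_id, C.reindex_id]

theorem ract_ident {X : V} {A B : C.Obj} (f : C.Hom X A B) : C.ract f (C.ident A) = f := by
  rw [ract, C.comp_ident, reindex_reindex, Iso.inv_hom_id, C.reindex_id]

theorem lact_eq_ract {A B E : C.Obj} (g : C.Hom (𝟙_ V) B E) (f : C.Hom (𝟙_ V) A B) :
    C.lact g f = C.ract g f := by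
  rw [lact, ract, unitors_inv_equal]

theorem ident_ract {A B : C.Obj} (f : C.Hom (𝟙_ V) A B) : C.ract (C.ident B) f = f := by
  rw [← lact_eq_ract, lact_ident]

theorem lact_lact {X : V} {A B E D : C.Obj} (h : C.Hom (𝟙_ V) E D) (g : C.Hom (𝟙_ V) B E)
    (f : C.Hom X A B) : C.lact (C.lact h g) f = C.lact h (C.lact g f) := by
  simp only [lact, comp_reindex_left, comp_reindex_right, C.assoc, reindex_reindex]
  congr 1
  monoidal

theorem ract_ract {X : V} {A B E D : C.Obj} (h : C.Hom X E D) (g : C.Hom (𝟙_ V) B E)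
    (f : C.Hom (𝟙_ V) A B) : C.ract (C.ract h g) f = C.ract h (C.ract g f) := by
  simp only [ract, comp_reindex_left, comp_reindex_right, C.assoc, reindex_reindex]
  congr 1
  monoidal

theorem lact_ract {X : V} {A B E D : C.Obj} (h : C.Hom (𝟙_ V) E D) (g : C.Hom X B E)
    (f : C.Hom (𝟙_ V) A B) : C.lact h (C.ract g f) = C.ract (C.lact h g) f := by
  simp only [lact, ract, comp_reindex_left, comp_reindex_right, C.assoc, reindex_reindex]
  congr 1
  monoidal

theorem lact_comp {X Y : V} {A B E D : C.Obj} (h : C.Hom (𝟙_ V) E D) (g : C.Hom Y B E)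
    (f : C.Hom X A B) : C.lact h (C.comp g f) = C.comp (C.lact h g) f := by
  simp only [lact, comp_reindex_left, C.assoc, reindex_reindex]
  congr 1
  monoidal

theorem ract_comp {X Y : V} {A B E D : C.Obj} (h : C.Hom Y E D) (g : C.Hom (𝟙_ V) B E)
    (f : C.Hom X A B) : C.comp (C.ract h g) f = C.comp h (C.lact g f) := by
  simp only [lact, ract, comp_reindex_left, comp_reindex_right, C.assoc, reindex_reindex]
  congr 1
  monoidal

theorem comp_ract {X Y : V} {A B E D : C.Obj} (h : C.Hom Y E D) (g : C.Hom X B E)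
    (f : C.Hom (𝟙_ V) A B) : C.comp h (C.ract g f) = C.ract (C.comp h g) f := by
  simp only [ract, comp_reindex_right, C.assoc, reindex_reindex]
  congr 1
  monoidal

theorem lact_reindex {X Y : V} {A B E : C.Obj} (h : C.Hom (𝟙_ V) B E) (α : Y ⟶ X)
    (f : C.Hom X A B) : C.lact h (C.reindex α f) = C.reindex α (C.lact h f) := by
  simp only [lact, comp_reindex_right, reindex_reindex]
  simp

theorem ract_reindex {X Y : V} {A B E : C.Obj} (α : Y ⟶ X) (h : C.Hom X B E)
    (f : C.Hom (𝟙_ V) A B) : C.ract (C.reindex α h) f = C.reindex α (C.ract h f) := by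
  simp only [ract, comp_reindex_left, reindex_reindex]
  simp

theorem reindex_inj {X Y : V} {A B : C.Obj} (α : Y ≅ X) {f g : C.Hom X A B} :
    C.reindex α.hom f = C.reindex α.hom g ↔ f = g := by
  refine ⟨fun h => ?_, fun h => by rw [h]⟩
  have := congrArg (C.reindex α.inv) h
  simpa [reindex_reindex, C.reindex_id] using this

end GradedCat

namespace GFunctor

variable {A B C D : GradedCat V}

/-- The identity `V`-graded functor. -/
def id (C : GradedCat V) : GFunctor C C where
  obj A := A
  map f := f
  map_reindex _ _ := rfl
  map_comp _ _ := rfl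
  map_ident _ := rfl

/-- The composite of `V`-graded functors (in diagrammatic order). -/
def comp (F : GFunctor A B) (G : GFunctor B C) : GFunctor A C where
  obj a := G.obj (F.obj a)
  map f := G.map (F.map f)
  map_reindex _ _ := by rw [F.map_reindex, G.map_reindex]
  map_comp _ _ := by rw [F.map_comp, G.map_comp]
  map_ident _ := by rw [F.map_ident, G.map_ident]

theorem map_lact (F : GFunctor A B) {X : V} {a b c : A.Obj} (h : A.Hom (𝟙_ V) b c)
    (f : A.Hom X a b) : F.map (A.lact h f) = B.lact (F.map h) (F.map f) := by
  simp only [GradedCat.lact, F.map_reindex, F.map_comp]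

theorem map_ract (F : GFunctor A B) {X : V} {a b c : A.Obj} (h : A.Hom X b c)
    (f : A.Hom (𝟙_ V) a b) : F.map (A.ract h f) = B.ract (F.map h) (F.map f) := by
  simp only [GradedCat.ract, F.map_reindex, F.map_comp]

end GFunctor

/-- A `V`-graded-natural transformation: a family of morphisms `δ_A : FA → GA` of the underlying
ordinary category with `(ℓ_X⁻¹)^*(δ_B ∘ Ff) = (r_X⁻¹)^*(Gf ∘ δ_A)` for every `f : X , A → B`. -/
@[ext]
structure GNat {C D : GradedCat V} (F G : GFunctor C D) where
  app : ∀ A : C.Obj, D.Hom (𝟙_ V) (F.obj A) (G.obj A)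
  naturality : ∀ {X : V} {A B : C.Obj} (f : C.Hom X A B),
    D.lact (app B) (F.map f) = D.ract (G.map f) (app A)

open GradedCat

/-- `V`-graded functors and `V`-graded-natural transformations form a category;
composition is componentwise in the underlying ordinary category. -/
instance (C D : GradedCat V) : Category.{u} (GFunctor C D) where
  Hom F G := GNat F G
  id F := ⟨fun A => D.ident (F.obj A), fun f => by rw [lact_ident, ract_ident]⟩
  comp η θ := ⟨fun A => D.lact (θ.app A) (η.app A), fun f => by
    rw [lact_lact, η.naturality, lact_ract, θ.naturality, ract_ract, lact_eq_ract]⟩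
  id_comp η := by
    apply GNat.ext; funext A
    exact (lact_eq_ract _ _).trans (ract_ident _)
  comp_id η := by
    apply GNat.ext; funext A
    exact lact_ident _
  assoc η θ κ := by
    apply GNat.ext; funext A
    exact (lact_lact _ _ _).symm

theorem GNat.id_app {C D : GradedCat V} (F : GFunctor C D) (A : C.Obj) :
    GNat.app (𝟙 F) A = D.ident (F.obj A) := rfl

theorem GNat.comp_app {C D : GradedCat V} {F G H : GFunctor C D} (η : F ⟶ G) (θ : G ⟶ H)
    (A : C.Obj) : GNat.app (η ≫ θ) A = D.lact (θ.app A) (η.app A) := rfl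

/-- The 2-category of (left) `V`-graded categories. -/
instance : Bicategory.{u, u} (GradedCat V) where
  Hom C D := GFunctor C D
  id C := GFunctor.id C
  comp F G := GFunctor.comp F G
  homCategory C D := inferInstance
  whiskerLeft F _ _ η := ⟨fun A => η.app (F.obj A), fun f => η.naturality (F.map f)⟩
  whiskerRight η H := ⟨fun A => H.map (η.app A), fun f => by
    have := congrArg H.map (η.naturality f)
    rwa [GFunctor.map_lact, GFunctor.map_ract] at this⟩
  associator F G H := Iso.refl (GFunctor.comp F (GFunctor.comp G H))
  leftUnitor F := Iso.refl F
  rightUnitor F := Iso.refl F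
  whiskerLeft_id _ _ := rfl
  whiskerLeft_comp _ _ _ _ _ _ := rfl
  id_whiskerLeft η := by
    refine Eq.trans ?_ ((Category.id_comp _).trans (Category.comp_id _)).symm
    rfl
  comp_whiskerLeft _ _ _ _ η := by
    refine Eq.trans ?_ ((Category.id_comp _).trans (Category.comp_id _)).symm
    rfl
  id_whiskerRight F G := GNat.ext (funext fun A => G.map_ident _)
  comp_whiskerRight η θ G := GNat.ext (funext fun A => GFunctor.map_lact G _ _)
  whiskerRight_id η := by
    refine Eq.trans ?_ ((Category.id_comp _).trans (Category.comp_id _)).symm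
    rfl
  whiskerRight_comp η G H := by
    refine Eq.trans ?_ ((Category.id_comp _).trans (Category.comp_id _)).symm
    rfl
  whisker_assoc F _ _ η H := by
    refine Eq.trans ?_ ((Category.id_comp _).trans (Category.comp_id _)).symm
    rfl
  whisker_exchange η θ := GNat.ext (funext fun A =>
    (lact_eq_ract _ _).trans (θ.naturality (η.app A)).symm)
  pentagon {_ _ _ D E} F G H K := GNat.ext (funext fun A => by
    change E.lact (E.lact (E.ident _) (E.ident _)) (K.map (D.ident _)) =
      E.lact (E.ident _) (E.ident _)
    rw [K.map_ident, lact_ident, lact_ident])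
  triangle {_ B C} F G := GNat.ext (funext fun A => by
    change C.lact (C.ident _) (C.ident _) = G.map (B.ident _)
    rw [G.map_ident, lact_ident])

instance : Bicategory.Strict (GradedCat V) where

end Basic

section ChangeOfBase

variable {V W : Type u} [Category.{v} V] [MonoidalCategory V] [Category.{v} W]
  [MonoidalCategory W]

open GradedCat Functor OplaxMonoidal

/-- Contravariant change of base along an opmonoidal functor `F : V ⥤ W`: graded morphisms of
grade `X` in `F^*C` are graded morphisms of grade `F X` in `C`. -/
abbrev baseObj (F : V ⥤ W) [F.OplaxMonoidal] (C : GradedCat W) : GradedCat V where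
  Obj := C.Obj
  Hom X A B := C.Hom (F.obj X) A B
  reindex α f := C.reindex (F.map α) f
  comp {X Y _ _ _} g f := C.reindex (δ F Y X) (C.comp g f)
  ident A := C.reindex (η F) (C.ident A)
  reindex_id f := by rw [F.map_id, C.reindex_id]
  reindex_comp α β f := by rw [F.map_comp, C.reindex_comp]
  comp_reindex β α g f := by
    rw [C.comp_reindex, reindex_reindex, reindex_reindex, δ_natural]
  assoc h g f := by
    simp only [comp_reindex_left, comp_reindex_right, C.assoc, reindex_reindex]
    congr 1
    simp
  comp_ident f := by
    rw [comp_reindex_right, C.comp_ident, reindex_reindex, reindex_reindex]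
    congr 1
    simp
  ident_comp f := by
    rw [comp_reindex_left, C.ident_comp, reindex_reindex, reindex_reindex]
    congr 1
    simp

/-- The action of change of base on graded functors. -/
def baseMap (F : V ⥤ W) [F.OplaxMonoidal] {C D : GradedCat W} (G : GFunctor C D) :
    GFunctor (baseObj F C) (baseObj F D) where
  obj := G.obj
  map f := G.map f
  map_reindex _ _ := G.map_reindex _ _
  map_comp g f := (G.map_reindex _ _).trans (congrArg _ (G.map_comp g f))
  map_ident A := (G.map_reindex _ _).trans (congrArg _ (G.map_ident A))

theorem base_lact (F : V ⥤ W) [F.OplaxMonoidal] {C : GradedCat W} {X : V} {A B E : C.Obj}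
    (h : C.Hom (𝟙_ W) B E) (f : C.Hom (F.obj X) A B) :
    (baseObj F C).lact (C.reindex (η F) h) f = C.lact h f := by
  change C.reindex (F.map _) (C.reindex (δ F _ _) (C.comp (C.reindex (η F) h) f)) = _
  rw [comp_reindex_left, reindex_reindex, reindex_reindex, lact]
  congr 1
  simp

theorem base_ract (F : V ⥤ W) [F.OplaxMonoidal] {C : GradedCat W} {X : V} {A B E : C.Obj}
    (h : C.Hom (F.obj X) B E) (f : C.Hom (𝟙_ W) A B) :
    (baseObj F C).ract h (C.reindex (η F) f) = C.ract h f := by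
  change C.reindex (F.map _) (C.reindex (δ F _ _) (C.comp h (C.reindex (η F) f))) = _
  rw [comp_reindex_right, reindex_reindex, reindex_reindex, ract]
  congr 1
  simp

/-- The action of change of base on graded-natural transformations: components are reindexed along
the counit constraint `F I ⟶ I`. -/
def baseMap₂ (F : V ⥤ W) [F.OplaxMonoidal] {C D : GradedCat W} {G H : GFunctor C D}
    (θ : G ⟶ H) : baseMap F G ⟶ baseMap F H where
  app A := D.reindex (η F) (θ.app A)
  naturality f := (base_lact F (C := D) _ _).trans
    ((θ.naturality f).trans (base_ract F (C := D) _ _).symm)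

/-- The 2-functor `F^*` from `W`-graded to `V`-graded categories. -/
def changeBase (F : V ⥤ W) [F.OplaxMonoidal] :
    StrictPseudofunctor (GradedCat W) (GradedCat V) := .mk''
  { obj := baseObj F
    map := baseMap F
    map₂ := baseMap₂ F
    map₂_id := fun _ => rfl
    map₂_comp {_ D _ _ _} θ κ := GNat.ext (funext fun A => by
      exact ((base_lact F (C := D) _ _).trans (lact_reindex _ _ _)).symm)
    map_id := fun _ => rfl
    map_comp := fun _ _ => rfl
    map₂_whisker_left := fun f _ _ θ => by
      exact ((Category.id_comp _).trans (Category.comp_id _)).symm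
    map₂_whisker_right := fun θ G => by
      refine Eq.trans ?_ ((Category.id_comp _).trans (Category.comp_id _)).symm
      exact GNat.ext (funext fun A => (G.map_reindex _ _).symm) }

end ChangeOfBase

section TwoFunctors

open Bicategory

universe w₁ w₂ w₃ v₁ v₂ v₃ u₁ u₂ u₃

variable {B : Type u₁} [Bicategory.{w₁, v₁} B] {C : Type u₂} [Bicategory.{w₂, v₂} C]
  {D : Type u₃} [Bicategory.{w₃, v₃} D]

/-- A 2-natural isomorphism between 2-functors (on strict 2-categories): a family of strictly
invertible 1-cells that is strictly natural with respect to 1-cells and 2-cells. -/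
structure TwoNatIso (F G : StrictPseudofunctor B C) where
  app : ∀ a : B, F.obj a ⟶ G.obj a
  inv : ∀ a : B, G.obj a ⟶ F.obj a
  app_inv : ∀ a : B, app a ≫ inv a = 𝟙 (F.obj a)
  inv_app : ∀ a : B, inv a ≫ app a = 𝟙 (G.obj a)
  naturality : ∀ {a b : B} (f : a ⟶ b), F.map f ≫ app b = app a ≫ G.map f
  naturality₂ : ∀ {a b : B} {f g : a ⟶ b} (θ : f ⟶ g),
    F.map₂ θ ▷ app b ≫ eqToHom (naturality g) = eqToHom (naturality f) ≫ app a ◁ G.map₂ θ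

/-- The pairing `a ↦ (F a, G a)` of two 2-functors. -/
def pairing [Strict B] [Strict C] [Strict D] (F : StrictPseudofunctor B C)
    (G : StrictPseudofunctor B D) :
    StrictPseudofunctor B (C × D) := .mk''
  { obj := fun a => (F.obj a, G.obj a)
    map := fun f => Prod.mkHom (F.map f) (G.map f)
    map₂ := fun θ => Prod.mkHom (F.map₂ θ) (G.map₂ θ)
    map₂_id := by intros; simp
    map₂_comp := by intros; simp
    map_id := by intros; simp [F.map_id, G.map_id]
    map_comp := by intros; simp [F.map_comp, G.map_comp]
    map₂_whisker_left := by
      intros; apply Prod.ext <;> simp [F.mapComp_eq_eqToIso, G.mapComp_eq_eqToIso]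
    map₂_whisker_right := by
      intros; apply Prod.ext <;> simp [F.mapComp_eq_eqToIso, G.mapComp_eq_eqToIso] }

end TwoFunctors

section HomTwoFunctor

open Bicategory Bicategory.Opposite GradedCat

variable {V : Type u} [Category.{v} V] [MonoidalCategory V]

/-- The functor `GCAT(A, C) ⥤ GCAT(A', C')` given by pre- and postcomposition. -/
def homMap {A A' C C' : GradedCat V} (P : A' ⟶ A) (R : C ⟶ C') : (A ⟶ C) ⥤ (A' ⟶ C') where
  obj F := P ≫ F ≫ R
  map {F G} θ := GNat.mk (F := P ≫ F ≫ R) (G := P ≫ G ≫ R) (fun a => R.map (θ.app (P.obj a)))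
    (fun f => (P ◁ (θ ▷ R) : P ≫ F ≫ R ⟶ P ≫ G ≫ R).naturality f)
  map_id F := GNat.ext (funext fun a => R.map_ident _)
  map_comp θ κ := GNat.ext (funext fun a => R.map_lact _ _)

/-- The transformation `homMap P R ⟶ homMap P' R'` given by horizontal composition
with `π : P ⟶ P'` and `ρ : R ⟶ R'`. -/
def homMap₂ {A A' C C' : GradedCat V} {P P' : A' ⟶ A} {R R' : C ⟶ C'} (π : P ⟶ P')
    (ρ : R ⟶ R') : homMap P R ⟶ homMap P' R' where
  app F := GNat.mk (F := P ≫ F ≫ R) (G := P' ≫ F ≫ R')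
    (fun a => C'.lact (ρ.app (F.obj (P'.obj a))) (R.map (F.map (π.app a))))
    (fun f => (π ▷ (F ≫ R) ≫ P' ◁ (F ◁ ρ) : P ≫ F ≫ R ⟶ P' ≫ F ≫ R').naturality f)
  naturality F G θ := GNat.ext (funext fun a => by
    change C'.lact (C'.lact (ρ.app (G.obj (P'.obj a))) (R.map (G.map (π.app a))))
        (R.map (θ.app (P.obj a))) =
      C'.lact (R'.map (θ.app (P'.obj a)))
        (C'.lact (ρ.app (F.obj (P'.obj a))) (R.map (F.map (π.app a))))
    rw [lact_lact, ← GFunctor.map_lact, lact_eq_ract (G.map _), ← θ.naturality,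
      ← lact_lact, lact_eq_ract (R'.map _), ← ρ.naturality, GFunctor.map_lact, lact_lact])

instance : Strict (GradedCat V)ᵒᵖ where
  leftUnitor_eqToIso _ := rfl
  rightUnitor_eqToIso _ := rfl
  associator_eqToIso _ _ _ := rfl

variable (V) in
/-- The 2-functor `(A, C) ↦ GCAT(A, C)`, contravariant in `A` and covariant in `C`. -/
def hom₂ : StrictPseudofunctor ((GradedCat V)ᵒᵖ × GradedCat V) Cat.{u, u} := .mk''
  { obj := fun a => Cat.of (a.1.unop ⟶ a.2)
    map := fun f => (homMap f.1.unop f.2).toCatHom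
    map₂ := fun θ => (homMap₂ θ.1.unop2 θ.2).toCatHom₂
    map₂_id := fun {_ b} f => Cat.Hom₂.ext (NatTrans.ext (funext fun F =>
      GNat.ext (funext fun x => by
        change b.2.lact (b.2.ident _) (f.2.map (F.map (GradedCat.ident _ _))) = b.2.ident _
        rw [lact_ident, F.map_ident, f.2.map_ident])))
    map₂_comp := fun {_ b f g h} θ κ => Cat.Hom₂.ext (NatTrans.ext (funext fun F =>
      GNat.ext (funext fun x => by
        change b.2.lact (b.2.lact (κ.2.app (F.obj (h.1.unop.obj x)))
            (θ.2.app (F.obj (h.1.unop.obj x))))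
            (f.2.map (F.map (GradedCat.lact _ (κ.1.unop2.app x) (θ.1.unop2.app x)))) =
          b.2.lact (b.2.lact (κ.2.app (F.obj (h.1.unop.obj x)))
              (g.2.map (F.map (κ.1.unop2.app x))))
            (b.2.lact (θ.2.app (F.obj (g.1.unop.obj x))) (f.2.map (F.map (θ.1.unop2.app x))))
        rw [F.map_lact, GFunctor.map_lact, lact_lact, lact_lact,
          ← lact_lact (θ.2.app _) (f.2.map _), θ.2.naturality, ← lact_eq_ract, lact_lact])))
    map_id := fun _ => rfl
    map_comp := fun _ _ => rfl
    map₂_whisker_left := fun f _ _ θ => by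
      refine Eq.trans ?_ ((Category.id_comp _).trans (Category.comp_id _)).symm
      rfl
    map₂_whisker_right := fun θ G => by
      refine Eq.trans ?_ ((Category.id_comp _).trans (Category.comp_id _)).symm
      exact Cat.Hom₂.ext (NatTrans.ext (funext fun F =>
        GNat.ext (funext fun x => (GFunctor.map_lact G.2 _ _).symm))) }

end HomTwoFunctor

section Bigraded

open Bicategory Bicategory.Opposite GradedCat Functor OplaxMonoidal CategoryTheory.Prod

variable {V W : Type u} [Category.{v} V] [MonoidalCategory V] [Category.{v} W]
  [MonoidalCategory W]

variable (V W) in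
/-- The functor `U_ℓ = (-, I) : V ⥤ V × W`. -/
abbrev Uℓ : V ⥤ V × W := CategoryTheory.Prod.sectL V (𝟙_ W)

variable (V W) in
/-- The functor `U_r = (I, -) : W ⥤ V × W`. -/
abbrev Ur : W ⥤ V × W := CategoryTheory.Prod.sectR (𝟙_ V) W

variable (V W) in
/-- The symmetry `W × V ⥤ V × W`. -/
abbrev symm : W × V ⥤ V × W := CategoryTheory.Prod.swap W V

/-- The strong monoidal structure of `U_ℓ`, as an opmonoidal structure. -/
instance : (Uℓ V W).OplaxMonoidal where
  η := 𝟙 _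
  δ X Y := Prod.mkHom (𝟙 (X ⊗ Y)) (λ_ (𝟙_ W)).inv
  δ_natural_left f X' := Prod.ext
    (by change 𝟙 _ ≫ f ▷ X' = f ▷ X' ≫ 𝟙 _; simp)
    (by change (λ_ (𝟙_ W)).inv ≫ 𝟙 (𝟙_ W) ▷ 𝟙_ W = 𝟙 _ ≫ (λ_ (𝟙_ W)).inv; simp)
  δ_natural_right X' f := Prod.ext
    (by change 𝟙 _ ≫ X' ◁ f = X' ◁ f ≫ 𝟙 _; simp)
    (by change (λ_ (𝟙_ W)).inv ≫ 𝟙_ W ◁ 𝟙 (𝟙_ W) = 𝟙 _ ≫ (λ_ (𝟙_ W)).inv; simp)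
  oplax_associativity X Y Z := Prod.ext
    (by change 𝟙 _ ≫ 𝟙 _ ▷ Z ≫ (α_ X Y Z).hom = (α_ X Y Z).hom ≫ 𝟙 _ ≫ X ◁ 𝟙 (Y ⊗ Z); simp)
    (by
      change (λ_ (𝟙_ W)).inv ≫ (λ_ (𝟙_ W)).inv ▷ 𝟙_ W ≫ (α_ (𝟙_ W) (𝟙_ W) (𝟙_ W)).hom =
        𝟙 _ ≫ (λ_ (𝟙_ W)).inv ≫ 𝟙_ W ◁ (λ_ (𝟙_ W)).inv
      monoidal)
  oplax_left_unitality X := Prod.ext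
    (by change (λ_ X).inv = (λ_ X).inv ≫ 𝟙 _ ≫ 𝟙 _ ▷ X; simp)
    (by change (λ_ (𝟙_ W)).inv = 𝟙 _ ≫ (λ_ (𝟙_ W)).inv ≫ 𝟙 (𝟙_ W) ▷ 𝟙_ W; simp)
  oplax_right_unitality X := Prod.ext
    (by change (ρ_ X).inv = (ρ_ X).inv ≫ 𝟙 _ ≫ X ◁ 𝟙 _; simp)
    (by change (ρ_ (𝟙_ W)).inv = 𝟙 _ ≫ (λ_ (𝟙_ W)).inv ≫ 𝟙_ W ◁ 𝟙 (𝟙_ W); monoidal)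

/-- The strong monoidal structure of `U_r`, as an opmonoidal structure. -/
instance : (Ur V W).OplaxMonoidal where
  η := 𝟙 _
  δ X Y := Prod.mkHom (λ_ (𝟙_ V)).inv (𝟙 (X ⊗ Y))
  δ_natural_left f X' := Prod.ext
    (by change (λ_ (𝟙_ V)).inv ≫ 𝟙 (𝟙_ V) ▷ 𝟙_ V = 𝟙 _ ≫ (λ_ (𝟙_ V)).inv; simp)
    (by change 𝟙 _ ≫ f ▷ X' = f ▷ X' ≫ 𝟙 _; simp)
  δ_natural_right X' f := Prod.ext
    (by change (λ_ (𝟙_ V)).inv ≫ 𝟙_ V ◁ 𝟙 (𝟙_ V) = 𝟙 _ ≫ (λ_ (𝟙_ V)).inv; simp)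
    (by change 𝟙 _ ≫ X' ◁ f = X' ◁ f ≫ 𝟙 _; simp)
  oplax_associativity X Y Z := Prod.ext
    (by
      change (λ_ (𝟙_ V)).inv ≫ (λ_ (𝟙_ V)).inv ▷ 𝟙_ V ≫ (α_ (𝟙_ V) (𝟙_ V) (𝟙_ V)).hom =
        𝟙 _ ≫ (λ_ (𝟙_ V)).inv ≫ 𝟙_ V ◁ (λ_ (𝟙_ V)).inv
      monoidal)
    (by change 𝟙 _ ≫ 𝟙 _ ▷ Z ≫ (α_ X Y Z).hom = (α_ X Y Z).hom ≫ 𝟙 _ ≫ X ◁ 𝟙 (Y ⊗ Z); simp)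
  oplax_left_unitality X := Prod.ext
    (by change (λ_ (𝟙_ V)).inv = 𝟙 _ ≫ (λ_ (𝟙_ V)).inv ≫ 𝟙 (𝟙_ V) ▷ 𝟙_ V; simp)
    (by change (λ_ X).inv = (λ_ X).inv ≫ 𝟙 _ ≫ 𝟙 _ ▷ X; simp)
  oplax_right_unitality X := Prod.ext
    (by change (ρ_ (𝟙_ V)).inv = 𝟙 _ ≫ (λ_ (𝟙_ V)).inv ≫ 𝟙_ V ◁ 𝟙 (𝟙_ V); monoidal)
    (by change (ρ_ X).inv = (ρ_ X).inv ≫ 𝟙 _ ≫ X ◁ 𝟙 _; simp)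

/-- The strict monoidal structure of the symmetry, as an opmonoidal structure. -/
instance : (symm V W).OplaxMonoidal where
  η := 𝟙 _
  δ X Y := 𝟙 _
  δ_natural_left f X' := by ext <;> simp
  δ_natural_right X' f := by ext <;> simp
  oplax_associativity X Y Z := by ext <;> simp
  oplax_left_unitality X := by ext <;> simp
  oplax_right_unitality X := by ext <;> simp

/-- Bigraded squares in a `(V × W)`-graded category: `f, g` are graded morphisms of grade `X` in
`U_ℓ^*C`, `φ, φ'` are graded morphisms of grade `X'` in `U_r^*C`, and
`(r_X⁻¹, ℓ_{X'}⁻¹)^*(g ∘ φ) = (ℓ_X⁻¹, r_{X'}⁻¹)^*(φ' ∘ f)`. -/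
def IsBigradedSquare (C : GradedCat (V × W)) {X : V} {X' : W} {A A' B B' : C.Obj}
    (f : C.Hom (X, 𝟙_ W) A A') (g : C.Hom (X, 𝟙_ W) B B')
    (φ : C.Hom (𝟙_ V, X') A B) (φ' : C.Hom (𝟙_ V, X') A' B') : Prop :=
  C.reindex (X := (X, 𝟙_ W) ⊗ (𝟙_ V, X')) (Prod.mkHom (ρ_ X).inv (λ_ X').inv) (C.comp g φ) =
    C.reindex (X := (𝟙_ V, X') ⊗ (X, 𝟙_ W)) (Prod.mkHom (λ_ X).inv (ρ_ X').inv) (C.comp φ' f)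

namespace IsBigradedSquare

variable {C : GradedCat (V × W)} {X : V} {X' Y' : W} {A A' B B' E E' : C.Obj}

theorem iff_comp {f : C.Hom (X, 𝟙_ W) A A'} {g : C.Hom (X, 𝟙_ W) B B'}
    {φ : C.Hom (𝟙_ V, X') A B} {φ' : C.Hom (𝟙_ V, X') A' B'} :
    IsBigradedSquare C f g φ φ' ↔ C.comp g φ =
      C.reindex (Y := (X, 𝟙_ W) ⊗ (𝟙_ V, X')) (X := (𝟙_ V, X') ⊗ (X, 𝟙_ W))
        (Prod.mkHom ((ρ_ X).hom ≫ (λ_ X).inv) ((λ_ X').hom ≫ (ρ_ X').inv)) (C.comp φ' f) := by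
  let e : (X, 𝟙_ W) ⊗ (𝟙_ V, X') ≅ (X, X') := Iso.prod (ρ_ X) (λ_ X')
  have h : e.symm.hom ≫ (Prod.mkHom ((ρ_ X).hom ≫ (λ_ X).inv) ((λ_ X').hom ≫ (ρ_ X').inv) :
      (X, 𝟙_ W) ⊗ (𝟙_ V, X') ⟶ (𝟙_ V, X') ⊗ (X, 𝟙_ W)) =
      Prod.mkHom (λ_ X).inv (ρ_ X').inv := Prod.ext (Iso.inv_hom_id_assoc (ρ_ X) _)
    (Iso.inv_hom_id_assoc (λ_ X') _)
  rw [← reindex_inj e.symm, reindex_reindex, h]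
  rfl

theorem reindex_right {f : C.Hom (X, 𝟙_ W) A A'} {g : C.Hom (X, 𝟙_ W) B B'}
    {φ : C.Hom (𝟙_ V, X') A B} {φ' : C.Hom (𝟙_ V, X') A' B'}
    (h : IsBigradedSquare C f g φ φ') (β : Y' ⟶ X') :
    IsBigradedSquare C f g (C.reindex (Prod.mkHom (𝟙 (𝟙_ V)) β) φ)
      (C.reindex (Prod.mkHom (𝟙 (𝟙_ V)) β) φ') := by
  rw [iff_comp] at h ⊢
  rw [comp_reindex_right, comp_reindex_left, h, reindex_reindex, reindex_reindex]
  congr 1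
  ext <;> simp

theorem ident_right (f : C.Hom (X, 𝟙_ W) A A') :
    IsBigradedSquare C f f (C.ident A) (C.ident A') := by
  unfold IsBigradedSquare
  erw [C.comp_ident, C.ident_comp, reindex_reindex, reindex_reindex]
  congr 1
  ext <;> simp [MonoidalCategory.unitors_equal, MonoidalCategory.unitors_inv_equal]

theorem comp_right {f : C.Hom (X, 𝟙_ W) A A'} {g : C.Hom (X, 𝟙_ W) B B'}
    {h : C.Hom (X, 𝟙_ W) E E'}
    {φ : C.Hom (𝟙_ V, X') A B} {φ' : C.Hom (𝟙_ V, X') A' B'}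
    {ψ : C.Hom (𝟙_ V, Y') B E} {ψ' : C.Hom (𝟙_ V, Y') B' E'}
    (s : IsBigradedSquare C f g φ φ') (t : IsBigradedSquare C g h ψ ψ') :
    IsBigradedSquare C f h
      (C.reindex (Y := (𝟙_ V, Y' ⊗ X')) (X := (𝟙_ V, Y') ⊗ (𝟙_ V, X'))
        (Prod.mkHom (λ_ (𝟙_ V)).inv (𝟙 (Y' ⊗ X'))) (C.comp ψ φ))
      (C.reindex (Y := (𝟙_ V, Y' ⊗ X')) (X := (𝟙_ V, Y') ⊗ (𝟙_ V, X'))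
        (Prod.mkHom (λ_ (𝟙_ V)).inv (𝟙 (Y' ⊗ X'))) (C.comp ψ' φ')) := by
  rw [iff_comp] at s t ⊢
  rw [comp_reindex_right, comp_reindex_left, assoc' h ψ φ, t, comp_reindex_left, C.assoc ψ' g φ, s,
    comp_reindex_right, assoc' ψ' φ' f]
  simp only [reindex_reindex]
  congr 1
  ext <;> simp

end IsBigradedSquare

theorem lact_paste {C : GradedCat V} {X : V} {A₁ A₂ A₃ B₁ B₂ B₃ : C.Obj} {f : C.Hom X A₁ B₁}
    {g : C.Hom X A₂ B₂} {h : C.Hom X A₃ B₃} {p : C.Hom (𝟙_ V) A₁ A₂} {q : C.Hom (𝟙_ V) B₁ B₂}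
    {r : C.Hom (𝟙_ V) A₂ A₃} {s : C.Hom (𝟙_ V) B₂ B₃} (h₁ : C.lact q f = C.ract g p)
    (h₂ : C.lact s g = C.ract h r) : C.lact (C.lact s q) f = C.ract h (C.lact r p) := by
  rw [lact_lact, h₁, lact_ract, h₂, ract_ract, lact_eq_ract r]

theorem lact_interchange {C : GradedCat V} {A B E B' E' D : C.Obj} {κ : C.Hom (𝟙_ V) E' D}
    {θ : C.Hom (𝟙_ V) E E'} {k : C.Hom (𝟙_ V) B E} {k' : C.Hom (𝟙_ V) B' E'}
    {θ' : C.Hom (𝟙_ V) B B'} {t : C.Hom (𝟙_ V) A B} (h : C.lact θ k = C.ract k' θ') :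
    C.lact (C.lact κ θ) (C.lact k t) = C.lact (C.lact κ k') (C.lact θ' t) := by
  rw [lact_lact, lact_lact, ← lact_lact θ, h, ← lact_eq_ract, lact_lact]

/-- Bigraded squares whose `φ, φ'` have grade `I`. -/
theorem IsBigradedSquare.unit_right_iff {C : GradedCat (V × W)} {X : V} {A A' B B' : C.Obj}
    {f : C.Hom (X, 𝟙_ W) A A'} {g : C.Hom (X, 𝟙_ W) B B'}
    {φ : C.Hom (𝟙_ (V × W)) A B} {φ' : C.Hom (𝟙_ (V × W)) A' B'} :
    IsBigradedSquare C f g φ φ' ↔ C.lact φ' f = C.ract g φ := by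
  have h₁ : (λ_ ((X, 𝟙_ W) : V × W)).inv = Prod.mkHom (λ_ X).inv (ρ_ (𝟙_ W)).inv :=
    Prod.ext rfl MonoidalCategory.unitors_inv_equal
  have h₂ : (ρ_ ((X, 𝟙_ W) : V × W)).inv = Prod.mkHom (ρ_ X).inv (λ_ (𝟙_ W)).inv :=
    Prod.ext rfl MonoidalCategory.unitors_inv_equal.symm
  rw [lact, ract, h₁, h₂]
  exact eq_comm

/-- Bigraded squares whose `f, g` have grade `I`. -/
theorem IsBigradedSquare.unit_left_iff {C : GradedCat (V × W)} {X' : W} {A A' B B' : C.Obj}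
    {f : C.Hom (𝟙_ (V × W)) A A'} {g : C.Hom (𝟙_ (V × W)) B B'}
    {φ : C.Hom (𝟙_ V, X') A B} {φ' : C.Hom (𝟙_ V, X') A' B'} :
    IsBigradedSquare C f g φ φ' ↔ C.lact g φ = C.ract φ' f := by
  have h₁ : (λ_ ((𝟙_ V, X') : V × W)).inv = Prod.mkHom (ρ_ (𝟙_ V)).inv (λ_ X').inv :=
    Prod.ext MonoidalCategory.unitors_inv_equal rfl
  have h₂ : (ρ_ ((𝟙_ V, X') : V × W)).inv = Prod.mkHom (λ_ (𝟙_ V)).inv (ρ_ X').inv :=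
    Prod.ext MonoidalCategory.unitors_inv_equal.symm rfl
  rw [lact, ract, h₁, h₂]
  exact Iff.rfl

theorem base_Uℓ_lact {C : GradedCat (V × W)} {X : V} {A B E : C.Obj}
    (h : C.Hom (𝟙_ (V × W)) B E) (f : C.Hom (X, 𝟙_ W) A B) :
    GradedCat.lact (baseObj (Uℓ V W) C) (X := X) h f = C.lact h f :=
  (congrArg (fun z => GradedCat.lact (baseObj (Uℓ V W) C) (X := X) z f)
    (C.reindex_id h).symm).trans (base_lact (Uℓ V W) (C := C) h f)

theorem base_Uℓ_ract {C : GradedCat (V × W)} {X : V} {A B E : C.Obj}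
    (h : C.Hom (X, 𝟙_ W) B E) (f : C.Hom (𝟙_ (V × W)) A B) :
    GradedCat.ract (baseObj (Uℓ V W) C) (X := X) h f = C.ract h f :=
  (congrArg (fun z => GradedCat.ract (baseObj (Uℓ V W) C) (X := X) h z)
    (C.reindex_id f).symm).trans (base_ract (Uℓ V W) (C := C) h f)

theorem base_Ur_lact {C : GradedCat (V × W)} {X : W} {A B E : C.Obj}
    (h : C.Hom (𝟙_ (V × W)) B E) (f : C.Hom (𝟙_ V, X) A B) :
    GradedCat.lact (baseObj (Ur V W) C) (X := X) h f = C.lact h f :=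
  (congrArg (fun z => GradedCat.lact (baseObj (Ur V W) C) (X := X) z f)
    (C.reindex_id h).symm).trans (base_lact (Ur V W) (C := C) h f)

theorem base_Ur_ract {C : GradedCat (V × W)} {X : W} {A B E : C.Obj}
    (h : C.Hom (𝟙_ V, X) B E) (f : C.Hom (𝟙_ (V × W)) A B) :
    GradedCat.ract (baseObj (Ur V W) C) (X := X) h f = C.ract h f :=
  (congrArg (fun z => GradedCat.ract (baseObj (Ur V W) C) (X := X) h z)
    (C.reindex_id f).symm).trans (base_ract (Ur V W) (C := C) h f)

/-- The `W`-graded category `[A, C]_r` of a `V`-graded category `A` and a `(V × W)`-graded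
category `C`: objects are `V`-graded functors `F : A → U_ℓ^*C`, and graded morphisms from `F` to
`G` of grade `X'` are families of graded morphisms `φ_a : F a → G a` in `U_r^*C` of grade `X'`
such that `(F f, G f, φ_a, φ_b)` is a bigraded square for every graded morphism `f : a → b`. -/
def bifuncCatR (A : GradedCat V) (C : GradedCat (V × W)) : GradedCat W where
  Obj := GFunctor A (baseObj (Uℓ V W) C)
  Hom X' F G := { φ : ∀ a : A.Obj, C.Hom (𝟙_ V, X') (F.obj a) (G.obj a) //
    ∀ {X : V} {a b : A.Obj} (f : A.Hom X a b),
      IsBigradedSquare C (F.map f) (G.map f) (φ a) (φ b) }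
  reindex α φ := ⟨fun a => (baseObj (Ur V W) C).reindex α (φ.1 a), fun f =>
    (φ.2 f).reindex_right α⟩
  comp ψ φ := ⟨fun a => (baseObj (Ur V W) C).comp (ψ.1 a) (φ.1 a), fun f =>
    (φ.2 f).comp_right (ψ.2 f)⟩
  ident F := ⟨fun a => (baseObj (Ur V W) C).ident (F.obj a), fun f => by
    change IsBigradedSquare C _ _ (C.reindex (𝟙 _) (C.ident _)) (C.reindex (𝟙 _) (C.ident _))
    rw [C.reindex_id, C.reindex_id]
    exact IsBigradedSquare.ident_right _⟩
  reindex_id φ := Subtype.ext (funext fun a => (baseObj (Ur V W) C).reindex_id _)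
  reindex_comp α β φ := Subtype.ext (funext fun a => (baseObj (Ur V W) C).reindex_comp _ _ _)
  comp_reindex β α ψ φ :=
    Subtype.ext (funext fun a => (baseObj (Ur V W) C).comp_reindex _ _ _ _)
  assoc χ ψ φ := Subtype.ext (funext fun a => (baseObj (Ur V W) C).assoc _ _ _)
  comp_ident φ := Subtype.ext (funext fun a => (baseObj (Ur V W) C).comp_ident _)
  ident_comp φ := Subtype.ext (funext fun a => (baseObj (Ur V W) C).ident_comp _)

theorem bifuncCatR_lact {A : GradedCat V} {C : GradedCat (V × W)}
    {F G H : (bifuncCatR A C).Obj} {X' : W} (ψ : (bifuncCatR A C).Hom (𝟙_ W) G H)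
    (φ : (bifuncCatR A C).Hom X' F G) (a : A.Obj) :
    ((bifuncCatR A C).lact ψ φ).1 a =
      GradedCat.lact C (X := (𝟙_ V, X')) (ψ.1 a) (φ.1 a) :=
  base_Ur_lact (C := C) (ψ.1 a) (φ.1 a)

theorem bifuncCatR_ract {A : GradedCat V} {C : GradedCat (V × W)}
    {F G H : (bifuncCatR A C).Obj} {X' : W} (ψ : (bifuncCatR A C).Hom X' G H)
    (φ : (bifuncCatR A C).Hom (𝟙_ W) F G) (a : A.Obj) :
    ((bifuncCatR A C).ract ψ φ).1 a =
      GradedCat.ract C (X := (𝟙_ V, X')) (ψ.1 a) (φ.1 a) :=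
  base_Ur_ract (C := C) (ψ.1 a) (φ.1 a)

theorem IsBigradedSquare.map {C D : GradedCat (V × W)} (R : GFunctor C D)
    {X : V} {X' : W} {A A' B B' : C.Obj}
    {f : C.Hom (X, 𝟙_ W) A A'} {g : C.Hom (X, 𝟙_ W) B B'}
    {φ : C.Hom (𝟙_ V, X') A B} {φ' : C.Hom (𝟙_ V, X') A' B'}
    (h : IsBigradedSquare C f g φ φ') :
    IsBigradedSquare D (R.map f) (R.map g) (R.map φ) (R.map φ') := by
  have := congrArg R.map h
  rwa [R.map_reindex, R.map_reindex, R.map_comp, R.map_comp] at this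

/-- The graded functor `[P, R]_r : F ↦ (U_ℓ^*R) F P`, `φ ↦ R φ_P`. -/
def bifuncMap {A A' : GradedCat V} {C C' : GradedCat (V × W)} (P : A' ⟶ A) (R : C ⟶ C') :
    bifuncCatR A C ⟶ bifuncCatR A' C' where
  obj F := GFunctor.comp P (GFunctor.comp F (baseMap (Uℓ V W) R))
  map φ := ⟨fun a => R.map (φ.1 (P.obj a)), fun f => (φ.2 (P.map f)).map R⟩
  map_reindex α φ := Subtype.ext (funext fun a => R.map_reindex _ _)
  map_comp ψ φ := Subtype.ext (funext fun a =>
    (R.map_reindex _ _).trans (congrArg _ (R.map_comp _ _)))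
  map_ident F := Subtype.ext (funext fun a =>
    (R.map_reindex _ _).trans (congrArg _ (R.map_ident _)))

/-- The 2-cell `[P, R]_r ⟶ [P', R']_r` induced by `π : P ⟶ P'` and `ρ : R ⟶ R'`; its component
at `F` is the horizontal composite of `π`, `F` and `ρ`. -/
def bifuncMap₂ {A A' : GradedCat V} {C C' : GradedCat (V × W)} {P P' : A' ⟶ A} {R R' : C ⟶ C'}
    (π : P ⟶ P') (ρ : R ⟶ R') : bifuncMap (W := W) P R ⟶ bifuncMap P' R' where
  app F := ⟨fun a => C'.lact (ρ.app (F.obj (P'.obj a))) (R.map (F.map (π.app a))),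
    fun {X a b} f => by
      refine IsBigradedSquare.unit_right_iff.2 ?_
      have h := (base_Uℓ_lact (C := C) _ _).symm.trans ((F.map_lact _ _).symm.trans
        ((congrArg F.map (π.naturality f)).trans ((F.map_ract _ _).trans
          (base_Uℓ_ract (C := C) _ _))))
      exact lact_paste ((R.map_lact _ _).symm.trans ((congrArg R.map h).trans (R.map_ract _ _)))
        (ρ.naturality _)⟩
  naturality {X' F G} φ := Subtype.ext (funext fun a => by
    refine (bifuncCatR_lact _ _ a).trans (Eq.trans ?_ (bifuncCatR_ract _ _ a).symm)
    have h := IsBigradedSquare.unit_left_iff.1 (φ.2 (π.app a))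
    exact lact_paste ((R.map_lact _ _).symm.trans ((congrArg R.map h).trans (R.map_ract _ _)))
      (ρ.naturality _))

variable (V W) in
/-- The 2-functor `(A, C) ↦ [A, C]_r`, contravariant in the `V`-graded category `A` and covariant
in the `(V × W)`-graded category `C`, with values in `W`-graded categories. -/
def bifuncR : StrictPseudofunctor ((GradedCat V)ᵒᵖ × GradedCat (V × W)) (GradedCat W) := .mk''
  { obj := fun a => bifuncCatR a.1.unop a.2
    map := fun f => bifuncMap f.1.unop f.2
    map₂ := fun θ => bifuncMap₂ θ.1.unop2 θ.2
    map₂_id := fun {_ b} f => GNat.ext (funext fun F => Subtype.ext (funext fun x => by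
        change b.2.lact (b.2.ident _) (f.2.map (F.map (GradedCat.ident _ _))) =
          b.2.reindex (𝟙 _) (b.2.ident _)
        rw [lact_ident, F.map_ident, f.2.map_reindex, f.2.map_ident]
        rfl))
    map₂_comp := fun {_ b f g h} θ κ => GNat.ext (funext fun F =>
      Subtype.ext (funext fun x => by
        refine Eq.trans ?_ (bifuncCatR_lact _ _ x).symm
        change b.2.lact (b.2.lact (κ.2.app (F.obj (h.1.unop.obj x)))
            (θ.2.app (F.obj (h.1.unop.obj x))))
            (f.2.map (F.map (GradedCat.lact _ (κ.1.unop2.app x) (θ.1.unop2.app x)))) =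
          b.2.lact (b.2.lact (κ.2.app (F.obj (h.1.unop.obj x)))
              (g.2.map (F.map (κ.1.unop2.app x))))
            (b.2.lact (θ.2.app (F.obj (g.1.unop.obj x))) (f.2.map (F.map (θ.1.unop2.app x))))
        refine Eq.trans (congrArg _ (Eq.trans (congrArg f.2.map
          ((GFunctor.map_lact F _ _).trans (base_Uℓ_lact (C := _) _ _)))
          (f.2.map_lact _ _))) ?_
        exact lact_interchange (θ.2.naturality _)))
    map_id := fun _ => rfl
    map_comp := fun _ _ => rfl
    map₂_whisker_left := fun f _ _ θ => by
      refine Eq.trans ?_ ((Category.id_comp _).trans (Category.comp_id _)).symm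
      rfl
    map₂_whisker_right := fun θ G => by
      refine Eq.trans ?_ ((Category.id_comp _).trans (Category.comp_id _)).symm
      exact GNat.ext (funext fun F => Subtype.ext (funext fun x =>
        (GFunctor.map_lact G.2 _ _).symm)) }

variable (V W) in
/-- The 2-functor `(B, C) ↦ [B, C]_ℓ = [B, symm^*C]_r`, contravariant in the `W`-graded category `B`
and covariant in the `(V × W)`-graded category `C`, with values in `V`-graded categories.
The objects of `[B, C]_ℓ` are `W`-graded functors `F : B → U_r^*C`, and its graded morphisms are
families `φ_b` in `U_ℓ^*C` such that `(φ_b, φ_b', F g, G g)` is a bigraded square in `C` for every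
graded morphism `g : b → b'`. -/
def bifuncL : StrictPseudofunctor ((GradedCat W)ᵒᵖ × GradedCat (V × W)) (GradedCat V) :=
  (pairing (Bicategory.Prod.fst _ _)
    ((Bicategory.Prod.snd _ _).comp (changeBase (symm V W)))).comp (bifuncR W V)

/-- A bigraded square in `C` is the same as a transposed bigraded square in `symm^*C`. -/
theorem IsBigradedSquare.symm_iff {C : GradedCat (V × W)} {X : V} {X' : W} {A A' B B' : C.Obj}
    {f : C.Hom (X, 𝟙_ W) A A'} {g : C.Hom (X, 𝟙_ W) B B'}
    {φ : C.Hom (𝟙_ V, X') A B} {φ' : C.Hom (𝟙_ V, X') A' B'} :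
    IsBigradedSquare (baseObj (symm V W) C) φ φ' f g ↔ IsBigradedSquare C f g φ φ' := by
  refine eq_comm.trans ?_
  change C.reindex _ (C.reindex (𝟙 _) (C.comp g φ)) =
    C.reindex _ (C.reindex (𝟙 _) (C.comp φ' f)) ↔ _
  rw [C.reindex_id, C.reindex_id]
  exact Iff.rfl

end Bigraded

section GradedBifunctors

open Bicategory Bicategory.Opposite GradedCat

variable {V W : Type u} [Category.{v} V] [MonoidalCategory V] [Category.{v} W]
  [MonoidalCategory W]

theorem lact_interchange₃ {C : GradedCat V} {x₁ x₂ x₃ x₄ x₅ x₆ y₁ y₂ y₃ y₄ : C.Obj}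
    {K : C.Hom (𝟙_ V) x₆ y₄} {T : C.Hom (𝟙_ V) x₅ x₆} {a : C.Hom (𝟙_ V) x₄ x₅}
    {b : C.Hom (𝟙_ V) x₃ x₄} {c : C.Hom (𝟙_ V) x₂ x₃} {d : C.Hom (𝟙_ V) x₁ x₂}
    {b' : C.Hom (𝟙_ V) x₂ y₁} {c' : C.Hom (𝟙_ V) y₁ x₄} {a' : C.Hom (𝟙_ V) y₃ x₆}
    {T₁ : C.Hom (𝟙_ V) x₄ y₃} {c'' : C.Hom (𝟙_ V) y₂ y₃} {T' : C.Hom (𝟙_ V) y₁ y₂}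
    (h₁ : C.lact b c = C.lact c' b') (h₂ : C.lact T a = C.lact a' T₁)
    (h₃ : C.lact T₁ c' = C.lact c'' T') :
    C.lact (C.lact K T) (C.lact (C.lact a b) (C.lact c d)) =
      C.lact (C.lact K (C.lact a' c'')) (C.lact T' (C.lact b' d)) := by
  rw [lact_lact, lact_lact a, ← lact_lact b, h₁, lact_lact c', ← lact_lact T, h₂, lact_lact a',
    ← lact_lact T₁, h₃, lact_lact c'', lact_lact K, lact_lact a']

/-- A graded sesquifunctor `F : A, B → C` valued in a `(V × W)`-graded category `C`: `V`-graded
functors `F(-, b) : A → U_ℓ^*C` and `W`-graded functors `F(a, -) : B → U_r^*C` that agree on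
objects. Here `mapL b f` is `F(f, b)` and `mapR a g` is `F(a, g)`. -/
structure Sesqui (A : GradedCat V) (B : GradedCat W) (C : GradedCat (V × W)) where
  obj : A.Obj → B.Obj → C.Obj
  mapL : ∀ (b : B.Obj) {X : V} {a a' : A.Obj}, A.Hom X a a' →
    (baseObj (Uℓ V W) C).Hom X (obj a b) (obj a' b)
  mapR : ∀ (a : A.Obj) {X : W} {b b' : B.Obj}, B.Hom X b b' →
    (baseObj (Ur V W) C).Hom X (obj a b) (obj a b')
  mapL_reindex : ∀ (b : B.Obj) {X Y : V} {a a' : A.Obj} (α : Y ⟶ X) (f : A.Hom X a a'),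
    mapL b (A.reindex α f) = (baseObj (Uℓ V W) C).reindex α (mapL b f)
  mapL_comp : ∀ (b : B.Obj) {X Y : V} {a a' a'' : A.Obj} (f' : A.Hom Y a' a'') (f : A.Hom X a a'),
    mapL b (A.comp f' f) = (baseObj (Uℓ V W) C).comp (mapL b f') (mapL b f)
  mapL_ident : ∀ (b : B.Obj) (a : A.Obj),
    mapL b (A.ident a) = (baseObj (Uℓ V W) C).ident (obj a b)
  mapR_reindex : ∀ (a : A.Obj) {X Y : W} {b b' : B.Obj} (β : Y ⟶ X) (g : B.Hom X b b'),
    mapR a (B.reindex β g) = (baseObj (Ur V W) C).reindex β (mapR a g)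
  mapR_comp : ∀ (a : A.Obj) {X Y : W} {b b' b'' : B.Obj} (g' : B.Hom Y b' b'') (g : B.Hom X b b'),
    mapR a (B.comp g' g) = (baseObj (Ur V W) C).comp (mapR a g') (mapR a g)
  mapR_ident : ∀ (a : A.Obj) (b : B.Obj),
    mapR a (B.ident b) = (baseObj (Ur V W) C).ident (obj a b)

/-- A transformation of graded sesquifunctors: a family of morphisms of the underlying ordinary
category that is graded-natural in each variable separately. -/
@[ext]
structure SesquiTrans {A : GradedCat V} {B : GradedCat W} {C : GradedCat (V × W)}
    (F G : Sesqui A B C) where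
  app : ∀ (a : A.Obj) (b : B.Obj), C.Hom (𝟙_ (V × W)) (F.obj a b) (G.obj a b)
  naturalL : ∀ (b : B.Obj) {X : V} {a a' : A.Obj} (f : A.Hom X a a'),
    GradedCat.lact (baseObj (Uℓ V W) C) (X := X) (app a' b) (F.mapL b f) =
      GradedCat.ract (baseObj (Uℓ V W) C) (X := X) (G.mapL b f) (app a b)
  naturalR : ∀ (a : A.Obj) {X : W} {b b' : B.Obj} (g : B.Hom X b b'),
    GradedCat.lact (baseObj (Ur V W) C) (X := X) (app a b') (F.mapR a g) =
      GradedCat.ract (baseObj (Ur V W) C) (X := X) (G.mapR a g) (app a b)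

namespace Sesqui

variable {A A' : GradedCat V} {B B' : GradedCat W} {C C' : GradedCat (V × W)}

/-- The `V`-graded functor `F(-, b) : A → U_ℓ^*C`. -/
def left (F : Sesqui A B C) (b : B.Obj) : GFunctor A (baseObj (Uℓ V W) C) where
  obj a := F.obj a b
  map f := F.mapL b f
  map_reindex := F.mapL_reindex b
  map_comp := F.mapL_comp b
  map_ident := F.mapL_ident b

/-- The `W`-graded functor `F(a, -) : B → U_r^*C`. -/
def right (F : Sesqui A B C) (a : A.Obj) : GFunctor B (baseObj (Ur V W) C) where
  obj b := F.obj a b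
  map g := F.mapR a g
  map_reindex := F.mapR_reindex a
  map_comp := F.mapR_comp a
  map_ident := F.mapR_ident a

/-- The graded sesquifunctor `(a, b) ↦ R F(P a, Q b)`. -/
def whisker (P : A' ⟶ A) (Q : B' ⟶ B) (R : C ⟶ C') (F : Sesqui A B C) : Sesqui A' B' C' where
  obj a b := R.obj (F.obj (P.obj a) (Q.obj b))
  mapL b _ _ _ f := R.map (F.mapL (Q.obj b) (P.map f))
  mapR a _ _ _ g := R.map (F.mapR (P.obj a) (Q.map g))
  mapL_reindex b :=
    (GFunctor.comp P (GFunctor.comp (F.left (Q.obj b)) (baseMap (Uℓ V W) R))).map_reindex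
  mapL_comp b :=
    (GFunctor.comp P (GFunctor.comp (F.left (Q.obj b)) (baseMap (Uℓ V W) R))).map_comp
  mapL_ident b :=
    (GFunctor.comp P (GFunctor.comp (F.left (Q.obj b)) (baseMap (Uℓ V W) R))).map_ident
  mapR_reindex a :=
    (GFunctor.comp Q (GFunctor.comp (F.right (P.obj a)) (baseMap (Ur V W) R))).map_reindex
  mapR_comp a :=
    (GFunctor.comp Q (GFunctor.comp (F.right (P.obj a)) (baseMap (Ur V W) R))).map_comp
  mapR_ident a :=
    (GFunctor.comp Q (GFunctor.comp (F.right (P.obj a)) (baseMap (Ur V W) R))).map_ident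

end Sesqui

/-- A graded bifunctor `F : A, B → C` valued in a `(V × W)`-graded category: a graded
sesquifunctor for which `(F(f, b), F(f, b'), F(a, g), F(a', g))` is always a bigraded square. -/
structure GBif (A : GradedCat V) (B : GradedCat W) (C : GradedCat (V × W)) extends
    Sesqui A B C where
  square : ∀ {X : V} {X' : W} {a a' : A.Obj} {b b' : B.Obj} (f : A.Hom X a a')
    (g : B.Hom X' b b'), IsBigradedSquare C (mapL b f) (mapL b' f) (mapR a g) (mapR a' g)

namespace GBif

variable {A A' : GradedCat V} {B B' : GradedCat W} {C C' : GradedCat (V × W)}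

theorem natL {F G : Sesqui A B C} (θ : SesquiTrans F G) (b : B.Obj) {X : V} {a a' : A.Obj}
    (f : A.Hom X a a') : GradedCat.lact C (X := (X, 𝟙_ W)) (θ.app a' b) (F.mapL b f) =
      GradedCat.ract C (X := (X, 𝟙_ W)) (G.mapL b f) (θ.app a b) :=
  (base_Uℓ_lact (C := C) _ _).symm.trans ((θ.naturalL b f).trans (base_Uℓ_ract (C := C) _ _))

theorem natR {F G : Sesqui A B C} (θ : SesquiTrans F G) (a : A.Obj) {X : W} {b b' : B.Obj}
    (g : B.Hom X b b') : GradedCat.lact C (X := (𝟙_ V, X)) (θ.app a b') (F.mapR a g) =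
      GradedCat.ract C (X := (𝟙_ V, X)) (G.mapR a g) (θ.app a b) :=
  (base_Ur_lact (C := C) _ _).symm.trans ((θ.naturalR a g).trans (base_Ur_ract (C := C) _ _))

/-- Transformations, with naturality expressed in `C`. -/
def mkTrans {F G : Sesqui A B C}
    (app : ∀ (a : A.Obj) (b : B.Obj), C.Hom (𝟙_ (V × W)) (F.obj a b) (G.obj a b))
    (hL : ∀ (b : B.Obj) {X : V} {a a' : A.Obj} (f : A.Hom X a a'),
      GradedCat.lact C (X := (X, 𝟙_ W)) (app a' b) (F.mapL b f) =
        GradedCat.ract C (X := (X, 𝟙_ W)) (G.mapL b f) (app a b))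
    (hR : ∀ (a : A.Obj) {X : W} {b b' : B.Obj} (g : B.Hom X b b'),
      GradedCat.lact C (X := (𝟙_ V, X)) (app a b') (F.mapR a g) =
        GradedCat.ract C (X := (𝟙_ V, X)) (G.mapR a g) (app a b)) : SesquiTrans F G where
  app := app
  naturalL b _ _ _ f := (base_Uℓ_lact (C := C) _ _).trans
    ((hL b f).trans (base_Uℓ_ract (C := C) _ _).symm)
  naturalR a _ _ _ g := (base_Ur_lact (C := C) _ _).trans
    ((hR a g).trans (base_Ur_ract (C := C) _ _).symm)

/-- Graded bifunctors and transformations of graded sesquifunctors form a category. -/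
instance : Category.{u} (GBif A B C) where
  Hom F G := SesquiTrans F.toSesqui G.toSesqui
  id F := mkTrans (fun a b => C.ident (F.obj a b))
    (fun b _ _ _ f => (lact_ident (C := C) (F.mapL b f)).trans
      (ract_ident (C := C) (F.mapL b f)).symm)
    (fun a _ _ _ g => (lact_ident (C := C) (F.mapR a g)).trans
      (ract_ident (C := C) (F.mapR a g)).symm)
  comp η θ := mkTrans (fun a b => C.lact (θ.app a b) (η.app a b))
    (fun b _ _ _ f => lact_paste (natL η b f) (natL θ b f))
    (fun a _ _ _ g => lact_paste (natR η a g) (natR θ a g))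
  id_comp η := SesquiTrans.ext (funext fun a => funext fun b =>
    (lact_eq_ract _ _).trans (ract_ident _))
  comp_id η := SesquiTrans.ext (funext fun a => funext fun b => lact_ident _)
  assoc η θ κ := SesquiTrans.ext (funext fun a => funext fun b => (lact_lact _ _ _).symm)

/-- The functor `GBif(A, B; C) ⥤ GBif(A', B'; C')`, `F ↦ R F(P -, Q -)`. -/
def map (P : A' ⟶ A) (Q : B' ⟶ B) (R : C ⟶ C') : GBif A B C ⥤ GBif A' B' C' where
  obj F := ⟨F.toSesqui.whisker P Q R, fun f g => (F.square (P.map f) (Q.map g)).map R⟩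
  map θ := mkTrans (fun a b => R.map (θ.app (P.obj a) (Q.obj b)))
    (fun b _ _ _ f => (R.map_lact _ _).symm.trans
      ((congrArg R.map (natL θ (Q.obj b) (P.map f))).trans (R.map_ract _ _)))
    (fun a _ _ _ g => (R.map_lact _ _).symm.trans
      ((congrArg R.map (natR θ (P.obj a) (Q.map g))).trans (R.map_ract _ _)))
  map_id F := SesquiTrans.ext (funext fun a => funext fun b => R.map_ident _)
  map_comp η θ := SesquiTrans.ext (funext fun a => funext fun b => R.map_lact _ _)

/-- The transformation induced by `π : P ⟶ P'`, `κ : Q ⟶ Q'` and `ρ : R ⟶ R'`. Its component at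
`(a, b)` is `ρ_{F(P' a, Q' b)} ∘ R F(P' a, κ_b) ∘ R F(π_a, Q b)`. -/
def map₂ {P P' : A' ⟶ A} {Q Q' : B' ⟶ B} {R R' : C ⟶ C'} (π : P ⟶ P') (κ : Q ⟶ Q')
    (ρ : R ⟶ R') : map P Q R ⟶ map P' Q' R' where
  app F := mkTrans (F := F.toSesqui.whisker P Q R) (G := F.toSesqui.whisker P' Q' R')
    (fun a b => C'.lact (ρ.app (F.obj (P'.obj a) (Q'.obj b)))
      (C'.lact (R.map (F.mapR (P'.obj a) (κ.app b))) (R.map (F.mapL (Q.obj b) (π.app a)))))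
    (fun b _ a a' f => lact_paste (lact_paste
      ((R.map_lact _ _).symm.trans ((congrArg R.map
        ((base_Uℓ_lact (C := C) _ _).symm.trans ((((F.left (Q.obj b)).map_lact _ _).symm.trans
        ((congrArg (F.left (Q.obj b)).map (π.naturality f)).trans
          ((F.left (Q.obj b)).map_ract _ _))).trans (base_Uℓ_ract (C := C) _ _)))).trans
        (R.map_ract _ _)))
      ((R.map_lact _ _).symm.trans ((congrArg R.map
        (IsBigradedSquare.unit_right_iff.1 (F.square (P'.map f) (κ.app b)))).trans
        (R.map_ract _ _)))) (ρ.naturality _))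
    (fun a _ b b' g => lact_paste (lact_paste
      ((R.map_lact _ _).symm.trans ((congrArg R.map
        (IsBigradedSquare.unit_left_iff.1 (F.square (π.app a) (Q.map g)))).trans
        (R.map_ract _ _)))
      ((R.map_lact _ _).symm.trans ((congrArg R.map
        ((base_Ur_lact (C := C) _ _).symm.trans ((((F.right (P'.obj a)).map_lact _ _).symm.trans
        ((congrArg (F.right (P'.obj a)).map (κ.naturality g)).trans
          ((F.right (P'.obj a)).map_ract _ _))).trans (base_Ur_ract (C := C) _ _)))).trans
        (R.map_ract _ _)))) (ρ.naturality _))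
  naturality F G θ := SesquiTrans.ext (funext fun a => funext fun b =>
    (lact_paste (lact_paste
      ((R.map_lact _ _).symm.trans ((congrArg R.map
        ((lact_eq_ract _ _).trans ((natL θ (Q.obj b) (π.app a)).symm.trans (lact_eq_ract _ _)))).trans (R.map_ract _ _)))
      ((R.map_lact _ _).symm.trans ((congrArg R.map
        ((lact_eq_ract _ _).trans ((natR θ (P'.obj a) (κ.app b)).symm.trans (lact_eq_ract _ _)))).trans
        (R.map_ract _ _))))
      (ρ.naturality _)).trans (lact_eq_ract _ _).symm)

end GBif

variable (V W) in
/-- The 2-functor `(A, B, C) ↦ GBif(A, B; C)`, contravariant in `A` and `B`, covariant in `C`. -/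
def gbif₂ : StrictPseudofunctor ((GradedCat V)ᵒᵖ × (GradedCat W)ᵒᵖ × GradedCat (V × W))
    Cat.{u, u} := .mk''
  { obj := fun a => Cat.of (GBif a.1.unop a.2.1.unop a.2.2)
    map := fun f => (GBif.map f.1.unop f.2.1.unop f.2.2).toCatHom
    map₂ := fun θ => (GBif.map₂ θ.1.unop2 θ.2.1.unop2 θ.2.2).toCatHom₂
    map₂_id := fun {_ b} f => Cat.Hom₂.ext (NatTrans.ext (funext fun F =>
      SesquiTrans.ext (funext fun x => funext fun y => by
        change b.2.2.lact (b.2.2.ident _) (b.2.2.lact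
          (f.2.2.map ((F.right _).map (GradedCat.ident _ _)))
          (f.2.2.map ((F.left _).map (GradedCat.ident _ _)))) = b.2.2.ident _
        refine (lact_ident _).trans ((congrArg₂ b.2.2.lact
          ((congrArg f.2.2.map (((F.right _).map_ident _).trans (GradedCat.reindex_id _ _))).trans
            (f.2.2.map_ident _))
          ((congrArg f.2.2.map (((F.left _).map_ident _).trans (GradedCat.reindex_id _ _))).trans
            (f.2.2.map_ident _))).trans (lact_ident _)))))
    map₂_comp := fun {_ b f g h} θ κ => Cat.Hom₂.ext (NatTrans.ext (funext fun F =>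
      SesquiTrans.ext (funext fun x => funext fun y =>
        (congrArg (b.2.2.lact _) (congrArg₂ b.2.2.lact
          ((congrArg f.2.2.map (((F.right _).map_lact _ _).trans
            (base_Ur_lact (C := _) _ _))).trans (f.2.2.map_lact _ _))
          ((congrArg f.2.2.map (((F.left _).map_lact _ _).trans
            (base_Uℓ_lact (C := _) _ _))).trans (f.2.2.map_lact _ _)))).trans
        (lact_interchange₃
          ((f.2.2.map_lact _ _).symm.trans ((congrArg f.2.2.map
            ((IsBigradedSquare.unit_right_iff.1 (F.square (κ.1.unop2.app x)
              (θ.2.1.unop2.app y))).trans (lact_eq_ract _ _).symm)).trans (f.2.2.map_lact _ _)))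
          ((θ.2.2.naturality _).trans (lact_eq_ract _ _).symm)
          ((θ.2.2.naturality _).trans (lact_eq_ract _ _).symm)))))
    map_id := fun _ => rfl
    map_comp := fun _ _ => rfl
    map₂_whisker_left := fun f _ _ θ => by
      refine Eq.trans ?_ ((Category.id_comp _).trans (Category.comp_id _)).symm
      exact Cat.Hom₂.ext (NatTrans.ext (funext fun F =>
        SesquiTrans.ext (funext fun x => funext fun y => rfl)))
    map₂_whisker_right := fun θ G => by
      refine Eq.trans ?_ ((Category.id_comp _).trans (Category.comp_id _)).symm
      exact Cat.Hom₂.ext (NatTrans.ext (funext fun F =>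
        SesquiTrans.ext (funext fun x => funext fun y =>
          ((G.2.2.map_lact _ _).trans (congrArg _ (G.2.2.map_lact _ _))).symm))) }

end GradedBifunctors

section DuoidalCategories

/-- A second monoidal structure `(⋆, J)` on a category, kept apart from the instance `(⊗, I)`. -/
class StarMonoidal (V : Type u) [Category.{v} V] where
  star : MonoidalCategory V

section StarNotation

variable {V : Type u} [Category.{v} V] [StarMonoidal V]

/-- The second tensor product `X ⋆ Y`. -/
abbrev sObj (X Y : V) : V := (StarMonoidal.star (V := V)).tensorObj X Y

infix:71 " ⋆ " => sObj

/-- The second tensor product of morphisms. -/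
abbrev sHom {X X' Y Y' : V} (f : X ⟶ X') (g : Y ⟶ Y') : X ⋆ Y ⟶ X' ⋆ Y' :=
  (StarMonoidal.star (V := V)).tensorHom f g

infix:71 " ⋆ₘ " => sHom

variable (V) in
/-- The unit object of the second monoidal structure. -/
abbrev sUnit : V := (StarMonoidal.star (V := V)).tensorUnit

/-- The associator of the second monoidal structure. -/
abbrev sAssoc (X Y Z : V) : (X ⋆ Y) ⋆ Z ≅ X ⋆ (Y ⋆ Z) :=
  (StarMonoidal.star (V := V)).associator X Y Z

/-- The left unitor of the second monoidal structure. -/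
abbrev sLeft (X : V) : sUnit V ⋆ X ≅ X := (StarMonoidal.star (V := V)).leftUnitor X

/-- The right unitor of the second monoidal structure. -/
abbrev sRight (X : V) : X ⋆ sUnit V ≅ X := (StarMonoidal.star (V := V)).rightUnitor X

theorem sHom_id (X Y : V) : (𝟙 X) ⋆ₘ (𝟙 Y) = 𝟙 (X ⋆ Y) :=
  (StarMonoidal.star (V := V)).id_tensorHom_id X Y

theorem sHom_comp {X X' X'' Y Y' Y'' : V} (f : X ⟶ X') (f' : X' ⟶ X'') (g : Y ⟶ Y')
    (g' : Y' ⟶ Y'') : (f ≫ f') ⋆ₘ (g ≫ g') = (f ⋆ₘ g) ≫ (f' ⋆ₘ g') :=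
  ((StarMonoidal.star (V := V)).tensorHom_comp_tensorHom f g f' g').symm

theorem sHom_inv_hom {X X' Y Y' : V} (e : X ≅ X') (e' : Y ≅ Y') :
    (e.inv ⋆ₘ e'.inv) ≫ (e.hom ⋆ₘ e'.hom) = 𝟙 _ := by
  rw [← sHom_comp, Iso.inv_hom_id, Iso.inv_hom_id, sHom_id]

end StarNotation

/-- A duoidal category `(V, ⊗, I, ⋆, J)`: a pseudomonoid in the 2-category of monoidal categories
`(V, ⊗, I)` and opmonoidal functors. Thus `⋆ : V × V → V` is opmonoidal, with constraints `ξ` and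
`μ`; `J` is an opmonoidal functor from the terminal monoidal category, that is, a comonoid with
comultiplication `γ` and counit `ν`; and the associator and the unitors for `⋆` are opmonoidal
transformations. -/
class Duoidal (V : Type u) [Category.{v} V] [MonoidalCategory V] [StarMonoidal V] where
  ξ : ∀ A B A' B' : V, (A ⊗ B) ⋆ (A' ⊗ B') ⟶ (A ⋆ A') ⊗ (B ⋆ B')
  μ : 𝟙_ V ⋆ 𝟙_ V ⟶ 𝟙_ V
  γ : sUnit V ⟶ sUnit V ⊗ sUnit V
  ν : sUnit V ⟶ 𝟙_ V
  ξ_natural : ∀ {A₁ A₂ B₁ B₂ A₁' A₂' B₁' B₂' : V} (f : A₁ ⟶ A₂) (g : B₁ ⟶ B₂) (f' : A₁' ⟶ A₂')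
    (g' : B₁' ⟶ B₂'), ((f ⊗ₘ g) ⋆ₘ (f' ⊗ₘ g')) ≫ ξ A₂ B₂ A₂' B₂' =
      ξ A₁ B₁ A₁' B₁' ≫ ((f ⋆ₘ f') ⊗ₘ (g ⋆ₘ g'))
  ξ_assoc : ∀ A B C A' B' C' : V,
    ξ (A ⊗ B) C (A' ⊗ B') C' ≫ (ξ A B A' B' ▷ (C ⋆ C')) ≫ (α_ _ _ _).hom =
      ((α_ A B C).hom ⋆ₘ (α_ A' B' C').hom) ≫ ξ A (B ⊗ C) A' (B' ⊗ C') ≫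
        ((A ⋆ A') ◁ ξ B C B' C')
  ξ_unit_left : ∀ A A' : V, ξ (𝟙_ V) A (𝟙_ V) A' ≫ (μ ▷ (A ⋆ A')) ≫ (λ_ (A ⋆ A')).hom =
    (λ_ A).hom ⋆ₘ (λ_ A').hom
  ξ_unit_right : ∀ A A' : V, ξ A (𝟙_ V) A' (𝟙_ V) ≫ ((A ⋆ A') ◁ μ) ≫ (ρ_ (A ⋆ A')).hom =
    (ρ_ A).hom ⋆ₘ (ρ_ A').hom
  γ_assoc : γ ≫ (γ ▷ sUnit V) ≫ (α_ _ _ _).hom = γ ≫ (sUnit V ◁ γ)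
  γ_counit_left : γ ≫ (ν ▷ sUnit V) ≫ (λ_ (sUnit V)).hom = 𝟙 (sUnit V)
  γ_counit_right : γ ≫ (sUnit V ◁ ν) ≫ (ρ_ (sUnit V)).hom = 𝟙 (sUnit V)
  assoc_ξ : ∀ A B A' B' A'' B'' : V,
    (ξ A B A' B' ⋆ₘ 𝟙 (A'' ⊗ B'')) ≫ ξ (A ⋆ A') (B ⋆ B') A'' B'' ≫
        ((sAssoc A A' A'').hom ⊗ₘ (sAssoc B B' B'').hom) =
      (sAssoc (A ⊗ B) (A' ⊗ B') (A'' ⊗ B'')).hom ≫ (𝟙 (A ⊗ B) ⋆ₘ ξ A' B' A'' B'') ≫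
        ξ A B (A' ⋆ A'') (B' ⋆ B'')
  assoc_μ : (μ ⋆ₘ 𝟙 (𝟙_ V)) ≫ μ = (sAssoc (𝟙_ V) (𝟙_ V) (𝟙_ V)).hom ≫ (𝟙 (𝟙_ V) ⋆ₘ μ) ≫ μ
  left_ξ : ∀ A B : V, (γ ⋆ₘ 𝟙 (A ⊗ B)) ≫ ξ (sUnit V) (sUnit V) A B ≫
    ((sLeft A).hom ⊗ₘ (sLeft B).hom) = (sLeft (A ⊗ B)).hom
  left_μ : (ν ⋆ₘ 𝟙 (𝟙_ V)) ≫ μ = (sLeft (𝟙_ V)).hom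
  right_ξ : ∀ A B : V, (𝟙 (A ⊗ B) ⋆ₘ γ) ≫ ξ A B (sUnit V) (sUnit V) ≫
    ((sRight A).hom ⊗ₘ (sRight B).hom) = (sRight (A ⊗ B)).hom
  right_μ : (𝟙 (𝟙_ V) ⋆ₘ ν) ≫ μ = (sRight (𝟙_ V)).hom

/-- A duoidal category is normal if `ν : J ⟶ I` is invertible. -/
class IsNormal (V : Type u) [Category.{v} V] [MonoidalCategory V] [StarMonoidal V]
  [Duoidal V] : Prop where
  isIso_ν : IsIso (Duoidal.ν (V := V))

attribute [instance] IsNormal.isIso_ν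

open Duoidal

section

variable (V : Type u) [Category.{v} V] [MonoidalCategory V] [StarMonoidal V]
  [Duoidal V]

/-- The functor `⋆ : V × V ⥤ V`. -/
abbrev starFunctor : V × V ⥤ V where
  obj X := X.1 ⋆ X.2
  map f := f.1 ⋆ₘ f.2
  map_id X := sHom_id X.1 X.2
  map_comp f g := sHom_comp f.1 g.1 f.2 g.2

/-- The opmonoidal structure of `⋆`, with constraints `ξ` and `μ`. -/
instance : (starFunctor V).OplaxMonoidal where
  η := μ
  δ X Y := ξ X.1 Y.1 X.2 Y.2
  δ_natural_left {X Y} f X' := by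
    have := ξ_natural f.1 (𝟙 X'.1) f.2 (𝟙 X'.2)
    rw [sHom_id] at this
    simp only [tensorHom_id] at this
    exact this.symm
  δ_natural_right {X Y} X' f := by
    have := ξ_natural (𝟙 X'.1) f.1 (𝟙 X'.2) f.2
    rw [sHom_id] at this
    simp only [id_tensorHom] at this
    exact this.symm
  oplax_associativity X Y Z := ξ_assoc X.1 Y.1 Z.1 X.2 Y.2 Z.2
  oplax_left_unitality X := by
    have h₁ : ((λ_ X.1).inv ⋆ₘ (λ_ X.2).inv) ≫ ((λ_ X.1).hom ⋆ₘ (λ_ X.2).hom) = 𝟙 _ := by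
      rw [← sHom_comp, Iso.inv_hom_id, Iso.inv_hom_id, sHom_id]
    have h₂ : ξ (𝟙_ V) X.1 (𝟙_ V) X.2 ≫ (μ ▷ (X.1 ⋆ X.2)) =
        ((λ_ X.1).hom ⋆ₘ (λ_ X.2).hom) ≫ (λ_ (X.1 ⋆ X.2)).inv := by
      rw [← ξ_unit_left, Category.assoc, Category.assoc, Iso.hom_inv_id, Category.comp_id]
    refine Eq.symm (Eq.trans (congrArg (((λ_ X.1).inv ⋆ₘ (λ_ X.2).inv) ≫ ·) h₂) ?_)
    exact (Category.assoc _ _ _).symm.trans ((congrArg (· ≫ _) h₁).trans (Category.id_comp _))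
  oplax_right_unitality X := by
    have h₁ : ((ρ_ X.1).inv ⋆ₘ (ρ_ X.2).inv) ≫ ((ρ_ X.1).hom ⋆ₘ (ρ_ X.2).hom) = 𝟙 _ := by
      rw [← sHom_comp, Iso.inv_hom_id, Iso.inv_hom_id, sHom_id]
    have h₂ : ξ X.1 (𝟙_ V) X.2 (𝟙_ V) ≫ ((X.1 ⋆ X.2) ◁ μ) =
        ((ρ_ X.1).hom ⋆ₘ (ρ_ X.2).hom) ≫ (ρ_ (X.1 ⋆ X.2)).inv := by
      rw [← ξ_unit_right, Category.assoc, Category.assoc, Iso.hom_inv_id, Category.comp_id]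
    refine Eq.symm (Eq.trans (congrArg (((ρ_ X.1).inv ⋆ₘ (ρ_ X.2).inv) ≫ ·) h₂) ?_)
    exact (Category.assoc _ _ _).symm.trans ((congrArg (· ≫ _) h₁).trans (Category.id_comp _))

end

end DuoidalCategories

section MoreSquares

open GradedCat

variable {V W : Type u} [Category.{v} V] [MonoidalCategory V] [Category.{v} W]
  [MonoidalCategory W]

namespace IsBigradedSquare

variable {C : GradedCat (V × W)} {X Y : V} {X' : W} {A A' A'' B B' B'' : C.Obj}

theorem ident_left (φ : C.Hom (𝟙_ V, X') A B) :
    IsBigradedSquare C (C.ident A) (C.ident B) φ φ :=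
  symm_iff.1 ((congrArg₂ (fun i j => IsBigradedSquare (baseObj (symm V W) C) φ φ i j)
    (C.reindex_id (C.ident A)) (C.reindex_id (C.ident B))).mp
      (ident_right (C := baseObj (symm V W) C) φ))

theorem reindex_left {f : C.Hom (X, 𝟙_ W) A A'} {g : C.Hom (X, 𝟙_ W) B B'}
    {φ : C.Hom (𝟙_ V, X') A B} {φ' : C.Hom (𝟙_ V, X') A' B'}
    (h : IsBigradedSquare C f g φ φ') (β : Y ⟶ X) :
    IsBigradedSquare C (C.reindex (Prod.mkHom β (𝟙 (𝟙_ W))) f)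
      (C.reindex (Prod.mkHom β (𝟙 (𝟙_ W))) g) φ φ' :=
  symm_iff.1 (reindex_right (C := baseObj (symm V W) C) (symm_iff.2 h) β)

theorem comp_left {f : C.Hom (X, 𝟙_ W) A A'} {g : C.Hom (X, 𝟙_ W) B B'}
    {f' : C.Hom (Y, 𝟙_ W) A' A''} {g' : C.Hom (Y, 𝟙_ W) B' B''}
    {φ : C.Hom (𝟙_ V, X') A B} {φ' : C.Hom (𝟙_ V, X') A' B'} {φ'' : C.Hom (𝟙_ V, X') A'' B''}
    (s : IsBigradedSquare C f g φ φ') (t : IsBigradedSquare C f' g' φ' φ'') :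
    IsBigradedSquare C ((baseObj (Uℓ V W) C).comp f' f) ((baseObj (Uℓ V W) C).comp g' g) φ φ'' :=
  symm_iff.1 ((congrArg₂ (fun i j => IsBigradedSquare (baseObj (symm V W) C) φ φ'' i j)
    (congrArg (C.reindex _) (C.reindex_id (C.comp f' f)))
    (congrArg (C.reindex _) (C.reindex_id (C.comp g' g)))).mp
      (comp_right (C := baseObj (symm V W) C) (symm_iff.2 s) (symm_iff.2 t)))

end IsBigradedSquare

end MoreSquares

noncomputable section GradedByDuoidal

open GradedCat Duoidal

variable {V : Type u} [Category.{v} V] [MonoidalCategory V] [StarMonoidal V] [Duoidal V]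

variable (V) in
/-- The 2-functor `C ↦ C_⋆ = ⋆^*C` from `V`-graded to `(V × V)`-graded categories. A graded morphism
of grade `(X, X')` in `C_⋆` is a graded morphism of grade `X ⋆ X'` in `C`. -/
def star₂ : StrictPseudofunctor (GradedCat V) (GradedCat (V × V)) := changeBase (starFunctor V)

/-- The `(V × V)`-graded category `C_⋆ = ⋆^*C`. -/
abbrev starCat (C : GradedCat V) : GradedCat (V × V) := baseObj (starFunctor V) C

variable [IsNormal V]

/-- The canonical isomorphism `X ⋆ I ≅ X ⋆ J ≅ X`. -/
def unitR (X : V) : X ⋆ 𝟙_ V ≅ X where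
  hom := (𝟙 X ⋆ₘ inv (ν (V := V))) ≫ (sRight X).hom
  inv := (sRight X).inv ≫ (𝟙 X ⋆ₘ ν (V := V))
  hom_inv_id := by
    rw [Category.assoc, Iso.hom_inv_id_assoc, ← sHom_comp, IsIso.inv_hom_id, Category.comp_id,
      sHom_id]
  inv_hom_id := by
    rw [Category.assoc, ← Category.assoc (_ ⋆ₘ _), ← sHom_comp, IsIso.hom_inv_id,
      Category.comp_id, sHom_id, Category.id_comp, Iso.inv_hom_id]

/-- The canonical isomorphism `I ⋆ X ≅ J ⋆ X ≅ X`. -/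
def unitL (X : V) : 𝟙_ V ⋆ X ≅ X where
  hom := (inv (ν (V := V)) ⋆ₘ 𝟙 X) ≫ (sLeft X).hom
  inv := (sLeft X).inv ≫ (ν (V := V) ⋆ₘ 𝟙 X)
  hom_inv_id := by
    rw [Category.assoc, Iso.hom_inv_id_assoc, ← sHom_comp, IsIso.inv_hom_id, Category.comp_id,
      sHom_id]
  inv_hom_id := by
    rw [Category.assoc, ← Category.assoc (_ ⋆ₘ _), ← sHom_comp, IsIso.hom_inv_id,
      Category.comp_id, sHom_id, Category.id_comp, Iso.inv_hom_id]

/-- The canonical morphism `σ : X ⋆ X' ⟶ X ⊗ X'`. -/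
def σ (X X' : V) : X ⋆ X' ⟶ X ⊗ X' :=
  ((ρ_ X).inv ⋆ₘ (λ_ X').inv) ≫ ξ X (𝟙_ V) (𝟙_ V) X' ≫ ((unitR X).hom ⊗ₘ (unitL X').hom)

/-- The canonical morphism `τ : X ⋆ X' ⟶ X' ⊗ X`. -/
def τ (X X' : V) : X ⋆ X' ⟶ X' ⊗ X :=
  ((λ_ X).inv ⋆ₘ (ρ_ X').inv) ≫ ξ (𝟙_ V) X X' (𝟙_ V) ≫ ((unitL X').hom ⊗ₘ (unitR X).hom)

/-- `V`-graded squares: `σ^*(g ∘ φ) = τ^*(φ' ∘ f)`. -/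
def IsVSquare (C : GradedCat V) {X X' : V} {A A' B B' : C.Obj} (f : C.Hom X A A')
    (g : C.Hom X B B') (φ : C.Hom X' A B) (φ' : C.Hom X' A' B') : Prop :=
  C.reindex (σ X X') (C.comp g φ) = C.reindex (τ X X') (C.comp φ' f)

theorem unitR_natural {X Y : V} (f : X ⟶ Y) :
    (f ⋆ₘ 𝟙 (𝟙_ V)) ≫ (unitR Y).hom = (unitR X).hom ≫ f := by
  have h : (f ⋆ₘ 𝟙 (sUnit V)) ≫ (sRight Y).hom = (sRight X).hom ≫ f := by
    have := (StarMonoidal.star (V := V)).rightUnitor_naturality f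
    rwa [← (StarMonoidal.star (V := V)).tensorHom_id] at this
  rw [unitR, unitR, Category.assoc, ← h, ← Category.assoc, ← Category.assoc, ← sHom_comp,
    ← sHom_comp]
  simp

theorem unitL_natural {X Y : V} (f : X ⟶ Y) :
    (𝟙 (𝟙_ V) ⋆ₘ f) ≫ (unitL Y).hom = (unitL X).hom ≫ f := by
  have h : (𝟙 (sUnit V) ⋆ₘ f) ≫ (sLeft Y).hom = (sLeft X).hom ≫ f := by
    have := (StarMonoidal.star (V := V)).leftUnitor_naturality f
    rwa [← (StarMonoidal.star (V := V)).id_tensorHom] at this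
  rw [unitL, unitL, Category.assoc, ← h, ← Category.assoc, ← Category.assoc, ← sHom_comp,
    ← sHom_comp]
  simp

theorem unitR_unit : (unitR (𝟙_ V)).hom = μ := by
  change (𝟙 (𝟙_ V) ⋆ₘ inv ν) ≫ (sRight (𝟙_ V)).hom = μ
  rw [← right_μ, ← Category.assoc, ← sHom_comp]
  simp [sHom_id]

theorem unitL_unit : (unitL (𝟙_ V)).hom = μ := by
  change (inv ν ⋆ₘ 𝟙 (𝟙_ V)) ≫ (sLeft (𝟙_ V)).hom = μ
  rw [← left_μ, ← Category.assoc, ← sHom_comp]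
  simp [sHom_id]

theorem inv_ν_γ : inv ν ≫ γ = (λ_ (𝟙_ V)).inv ≫ (inv ν ⊗ₘ inv ν) := by
  have h₁ : γ ≫ (ν (V := V) ▷ sUnit V) = (λ_ (sUnit V)).inv := by
    rw [← Category.comp_id (γ ≫ _), ← Iso.hom_inv_id (λ_ (sUnit V)), ← Category.assoc,
      Category.assoc γ, γ_counit_left, Category.id_comp]
  have h₂ : γ ≫ (ν (V := V) ⊗ₘ ν) = ν ≫ (λ_ (𝟙_ V)).inv := by
    rw [MonoidalCategory.tensorHom_def, ← Category.assoc, h₁, leftUnitor_inv_naturality]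
  have h₃ : (ν (V := V) ⊗ₘ ν) ≫ (inv ν ⊗ₘ inv ν) = 𝟙 _ := by
    rw [tensorHom_comp_tensorHom, IsIso.hom_inv_id, id_tensorHom_id]
  rw [IsIso.inv_comp_eq, ← Category.assoc, ← h₂, Category.assoc, h₃, Category.comp_id]

theorem unitR_tensor (X Y : V) : (𝟙 (X ⊗ Y) ⋆ₘ (λ_ (𝟙_ V)).inv) ≫ ξ X Y (𝟙_ V) (𝟙_ V) ≫
    ((unitR X).hom ⊗ₘ (unitR Y).hom) = (unitR (X ⊗ Y)).hom := by
  have h : ξ X Y (𝟙_ V) (𝟙_ V) ≫ ((𝟙 X ⋆ₘ inv ν) ⊗ₘ (𝟙 Y ⋆ₘ inv ν)) =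
      (𝟙 (X ⊗ Y) ⋆ₘ (inv ν ⊗ₘ inv ν)) ≫ ξ X Y (sUnit V) (sUnit V) := by
    rw [← ξ_natural, id_tensorHom_id]
  simp only [unitR]
  rw [← tensorHom_comp_tensorHom, reassoc_of% h, ← right_ξ, ← Category.assoc, ← sHom_comp,
    ← inv_ν_γ, sHom_comp, Category.assoc]

theorem unitL_tensor (X Y : V) : ((λ_ (𝟙_ V)).inv ⋆ₘ 𝟙 (X ⊗ Y)) ≫ ξ (𝟙_ V) (𝟙_ V) X Y ≫
    ((unitL X).hom ⊗ₘ (unitL Y).hom) = (unitL (X ⊗ Y)).hom := by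
  have h : ξ (𝟙_ V) (𝟙_ V) X Y ≫ ((inv ν ⋆ₘ 𝟙 X) ⊗ₘ (inv ν ⋆ₘ 𝟙 Y)) =
      ((inv ν ⊗ₘ inv ν) ⋆ₘ 𝟙 (X ⊗ Y)) ≫ ξ (sUnit V) (sUnit V) X Y := by
    rw [← ξ_natural, id_tensorHom_id]
  simp only [unitL]
  rw [← tensorHom_comp_tensorHom, reassoc_of% h, ← left_ξ, ← Category.assoc, ← sHom_comp,
    ← inv_ν_γ, sHom_comp, Category.assoc]

theorem σ_unit_right (X : V) : σ X (𝟙_ V) = (unitR X).hom ≫ (ρ_ X).inv := by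
  have h : ξ X (𝟙_ V) (𝟙_ V) (𝟙_ V) ≫ ((X ⋆ 𝟙_ V) ◁ μ) =
      ((ρ_ X).hom ⋆ₘ (ρ_ (𝟙_ V)).hom) ≫ (ρ_ (X ⋆ 𝟙_ V)).inv := by
    rw [← ξ_unit_right, Category.assoc, Category.assoc, Iso.hom_inv_id, Category.comp_id]
  rw [σ, unitL_unit, MonoidalCategory.tensorHom_def', ← Category.assoc (ξ _ _ _ _), h,
    MonoidalCategory.unitors_inv_equal, Category.assoc, ← Category.assoc (_ ⋆ₘ _), sHom_inv_hom,
    Category.id_comp, rightUnitor_inv_naturality]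

theorem τ_unit_right (X : V) : τ X (𝟙_ V) = (unitR X).hom ≫ (λ_ X).inv := by
  have h : ξ (𝟙_ V) X (𝟙_ V) (𝟙_ V) ≫ (μ ▷ (X ⋆ 𝟙_ V)) =
      ((λ_ X).hom ⋆ₘ (λ_ (𝟙_ V)).hom) ≫ (λ_ (X ⋆ 𝟙_ V)).inv := by
    rw [← ξ_unit_left, Category.assoc, Category.assoc, Iso.hom_inv_id, Category.comp_id]
  rw [τ, unitL_unit, MonoidalCategory.tensorHom_def, ← Category.assoc (ξ _ _ _ _), h,
    ← MonoidalCategory.unitors_inv_equal, Category.assoc, ← Category.assoc (_ ⋆ₘ _), sHom_inv_hom,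
    Category.id_comp, leftUnitor_inv_naturality]

theorem σ_unit_left (X : V) : σ (𝟙_ V) X = (unitL X).hom ≫ (λ_ X).inv := by
  have h : ξ (𝟙_ V) (𝟙_ V) (𝟙_ V) X ≫ (μ ▷ (𝟙_ V ⋆ X)) =
      ((λ_ (𝟙_ V)).hom ⋆ₘ (λ_ X).hom) ≫ (λ_ (𝟙_ V ⋆ X)).inv := by
    rw [← ξ_unit_left, Category.assoc, Category.assoc, Iso.hom_inv_id, Category.comp_id]
  rw [σ, unitR_unit, MonoidalCategory.tensorHom_def, ← Category.assoc (ξ _ _ _ _), h,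
    ← MonoidalCategory.unitors_inv_equal, Category.assoc, ← Category.assoc (_ ⋆ₘ _), sHom_inv_hom,
    Category.id_comp, leftUnitor_inv_naturality]

theorem τ_unit_left (X : V) : τ (𝟙_ V) X = (unitL X).hom ≫ (ρ_ X).inv := by
  have h : ξ (𝟙_ V) (𝟙_ V) X (𝟙_ V) ≫ ((𝟙_ V ⋆ X) ◁ μ) =
      ((ρ_ (𝟙_ V)).hom ⋆ₘ (ρ_ X).hom) ≫ (ρ_ (𝟙_ V ⋆ X)).inv := by
    rw [← ξ_unit_right, Category.assoc, Category.assoc, Iso.hom_inv_id, Category.comp_id]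
  rw [τ, unitR_unit, MonoidalCategory.tensorHom_def', ← Category.assoc (ξ _ _ _ _), h,
    MonoidalCategory.unitors_inv_equal, Category.assoc, ← Category.assoc (_ ⋆ₘ _), sHom_inv_hom,
    Category.id_comp, rightUnitor_inv_naturality]

/-- The `V`-graded functor `L : C → U_ℓ^*C_⋆`, given by reindexing along `X ⋆ I ≅ X`. -/
def toStarL (C : GradedCat V) : GFunctor C (baseObj (Uℓ V V) (starCat C)) where
  obj A := A
  map {X _ _} f := C.reindex (unitR X).hom f
  map_reindex α f := by
    exact (reindex_reindex _ _ _).trans ((congrArg (C.reindex · f) (unitR_natural α).symm).trans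
      (reindex_reindex _ _ _).symm)
  map_comp {X Y _ _ _} g f := by
    have h : C.reindex (𝟙 (Y ⊗ X) ⋆ₘ (λ_ (𝟙_ V)).inv) (C.reindex (ξ Y X (𝟙_ V) (𝟙_ V))
        (C.comp (C.reindex (unitR Y).hom g) (C.reindex (unitR X).hom f))) =
        C.reindex (unitR (Y ⊗ X)).hom (C.comp g f) := by
      rw [C.comp_reindex, reindex_reindex, reindex_reindex, Category.assoc, unitR_tensor]
    exact h.symm
  map_ident A := by
    have h : C.reindex (𝟙 (𝟙_ V) ⋆ₘ 𝟙 (𝟙_ V)) (C.reindex μ (C.ident A)) =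
        C.reindex (unitR (𝟙_ V)).hom (C.ident A) := by
      rw [sHom_id, C.reindex_id, unitR_unit]
    exact h.symm

/-- The `V`-graded functor `R : C → U_r^*C_⋆`, given by reindexing along `I ⋆ X ≅ X`. -/
def toStarR (C : GradedCat V) : GFunctor C (baseObj (Ur V V) (starCat C)) where
  obj A := A
  map {X _ _} f := C.reindex (unitL X).hom f
  map_reindex α f := by
    exact (reindex_reindex _ _ _).trans ((congrArg (C.reindex · f) (unitL_natural α).symm).trans
      (reindex_reindex _ _ _).symm)
  map_comp {X Y _ _ _} g f := by
    have h : C.reindex ((λ_ (𝟙_ V)).inv ⋆ₘ 𝟙 (Y ⊗ X)) (C.reindex (ξ (𝟙_ V) (𝟙_ V) Y X)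
        (C.comp (C.reindex (unitL Y).hom g) (C.reindex (unitL X).hom f))) =
        C.reindex (unitL (Y ⊗ X)).hom (C.comp g f) := by
      rw [C.comp_reindex, reindex_reindex, reindex_reindex, Category.assoc, unitL_tensor]
    exact h.symm
  map_ident A := by
    have h : C.reindex (𝟙 (𝟙_ V) ⋆ₘ 𝟙 (𝟙_ V)) (C.reindex μ (C.ident A)) =
        C.reindex (unitL (𝟙_ V)).hom (C.ident A) := by
      rw [sHom_id, C.reindex_id, unitL_unit]
    exact h.symm

namespace IsVSquare

variable {C : GradedCat V} {X X' Y Y' : V} {A A' A'' B B' B'' : C.Obj}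

theorem iff_bigraded {f : C.Hom X A A'} {g : C.Hom X B B'} {φ : C.Hom X' A B}
    {φ' : C.Hom X' A' B'} : IsBigradedSquare (starCat C) ((toStarL C).map f) ((toStarL C).map g)
      ((toStarR C).map φ) ((toStarR C).map φ') ↔ IsVSquare C f g φ φ' := by
  change C.reindex ((ρ_ X).inv ⋆ₘ (λ_ X').inv) (C.reindex (ξ X (𝟙_ V) (𝟙_ V) X')
      (C.comp (C.reindex (unitR X).hom g) (C.reindex (unitL X').hom φ))) =
    C.reindex ((λ_ X).inv ⋆ₘ (ρ_ X').inv) (C.reindex (ξ (𝟙_ V) X X' (𝟙_ V))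
      (C.comp (C.reindex (unitL X').hom φ') (C.reindex (unitR X).hom f))) ↔ _
  rw [C.comp_reindex, C.comp_reindex, reindex_reindex, reindex_reindex, reindex_reindex,
    reindex_reindex, Category.assoc, Category.assoc]
  exact Iff.rfl

theorem unit_right_iff {f : C.Hom X A A'} {g : C.Hom X B B'} {φ : C.Hom (𝟙_ V) A B}
    {φ' : C.Hom (𝟙_ V) A' B'} : IsVSquare C f g φ φ' ↔ C.lact φ' f = C.ract g φ := by
  rw [IsVSquare, σ_unit_right, τ_unit_right, C.reindex_comp, C.reindex_comp, reindex_inj, eq_comm]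
  exact Iff.rfl

theorem unit_left_iff {f : C.Hom (𝟙_ V) A A'} {g : C.Hom (𝟙_ V) B B'} {φ : C.Hom X' A B}
    {φ' : C.Hom X' A' B'} : IsVSquare C f g φ φ' ↔ C.lact g φ = C.ract φ' f := by
  rw [IsVSquare, σ_unit_left, τ_unit_left, C.reindex_comp, C.reindex_comp, reindex_inj]
  exact Iff.rfl

theorem map {D : GradedCat V} (R : GFunctor C D) {f : C.Hom X A A'} {g : C.Hom X B B'}
    {φ : C.Hom X' A B} {φ' : C.Hom X' A' B'} (h : IsVSquare C f g φ φ') :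
    IsVSquare D (R.map f) (R.map g) (R.map φ) (R.map φ') := by
  have := congrArg R.map h
  rwa [R.map_reindex, R.map_reindex, R.map_comp, R.map_comp] at this

theorem ident_right (f : C.Hom X A A') : IsVSquare C f f (C.ident A) (C.ident A') :=
  unit_right_iff.2 ((lact_ident f).trans (ract_ident f).symm)

theorem ident_left (φ : C.Hom X' A B) : IsVSquare C (C.ident A) (C.ident B) φ φ :=
  unit_left_iff.2 ((lact_ident φ).trans (ract_ident φ).symm)

theorem reindex_right {f : C.Hom X A A'} {g : C.Hom X B B'} {φ : C.Hom X' A B}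
    {φ' : C.Hom X' A' B'} (h : IsVSquare C f g φ φ') (β : Y' ⟶ X') :
    IsVSquare C f g (C.reindex β φ) (C.reindex β φ') := by
  rw [← iff_bigraded, (toStarR C).map_reindex, (toStarR C).map_reindex]
  exact (iff_bigraded.2 h).reindex_right β

theorem reindex_left {f : C.Hom X A A'} {g : C.Hom X B B'} {φ : C.Hom X' A B}
    {φ' : C.Hom X' A' B'} (h : IsVSquare C f g φ φ') (β : Y ⟶ X) :
    IsVSquare C (C.reindex β f) (C.reindex β g) φ φ' := by
  rw [← iff_bigraded, (toStarL C).map_reindex, (toStarL C).map_reindex]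
  exact (iff_bigraded.2 h).reindex_left β

theorem comp_right {f : C.Hom X A A'} {g : C.Hom X B B'} {h : C.Hom X A'' B''}
    {φ : C.Hom X' A B} {φ' : C.Hom X' A' B'} {ψ : C.Hom Y' B A''} {ψ' : C.Hom Y' B' B''}
    (s : IsVSquare C f g φ φ') (t : IsVSquare C g h ψ ψ') :
    IsVSquare C f h (C.comp ψ φ) (C.comp ψ' φ') := by
  rw [← iff_bigraded, (toStarR C).map_comp, (toStarR C).map_comp]
  exact (iff_bigraded.2 s).comp_right (iff_bigraded.2 t)

theorem comp_left {f : C.Hom X A A'} {g : C.Hom X B B'} {f' : C.Hom Y A' A''}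
    {g' : C.Hom Y B' B''} {φ : C.Hom X' A B} {φ' : C.Hom X' A' B'} {φ'' : C.Hom X' A'' B''}
    (s : IsVSquare C f g φ φ') (t : IsVSquare C f' g' φ' φ'') :
    IsVSquare C (C.comp f' f) (C.comp g' g) φ φ'' := by
  rw [← iff_bigraded, (toStarL C).map_comp, (toStarL C).map_comp]
  exact (iff_bigraded.2 s).comp_left (iff_bigraded.2 t)

end IsVSquare

end GradedByDuoidal

section GradedFunctorCategories

open GradedCat

variable {V : Type u} [Category.{v} V] [MonoidalCategory V] [StarMonoidal V] [Duoidal V]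
  [IsNormal V]

/-- The `V`-graded category `[A, C]_r`: objects are `V`-graded functors `A → C`; graded morphisms
from `F` to `G` of grade `X'` are families of graded morphisms `φ_a : F a → G a` of grade `X'` such
that `(F f, G f, φ_a, φ_b)` is a `V`-graded square for every graded morphism `f : a → b`. -/
def funcCatR (A C : GradedCat V) : GradedCat V where
  Obj := GFunctor A C
  Hom X' F G := { φ : ∀ a : A.Obj, C.Hom X' (F.obj a) (G.obj a) //
    ∀ {X : V} {a b : A.Obj} (f : A.Hom X a b), IsVSquare C (F.map f) (G.map f) (φ a) (φ b) }
  reindex α φ := ⟨fun a => C.reindex α (φ.1 a), fun f => (φ.2 f).reindex_right α⟩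
  comp ψ φ := ⟨fun a => C.comp (ψ.1 a) (φ.1 a), fun f => (φ.2 f).comp_right (ψ.2 f)⟩
  ident F := ⟨fun a => C.ident (F.obj a), fun f => IsVSquare.ident_right (F.map f)⟩
  reindex_id φ := Subtype.ext (funext fun a => C.reindex_id _)
  reindex_comp α β φ := Subtype.ext (funext fun a => C.reindex_comp _ _ _)
  comp_reindex β α ψ φ := Subtype.ext (funext fun a => C.comp_reindex _ _ _ _)
  assoc χ ψ φ := Subtype.ext (funext fun a => C.assoc _ _ _)
  comp_ident φ := Subtype.ext (funext fun a => C.comp_ident _)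
  ident_comp φ := Subtype.ext (funext fun a => C.ident_comp _)

/-- The `V`-graded category `[A, C]_ℓ`: objects are `V`-graded functors `A → C`; graded morphisms
from `F` to `G` of grade `X'` are families of graded morphisms `φ_a : F a → G a` of grade `X'` such
that `(φ_a, φ_b, F f, G f)` is a `V`-graded square for every graded morphism `f : a → b`. -/
def funcCatL (A C : GradedCat V) : GradedCat V where
  Obj := GFunctor A C
  Hom X' F G := { φ : ∀ a : A.Obj, C.Hom X' (F.obj a) (G.obj a) //
    ∀ {X : V} {a b : A.Obj} (f : A.Hom X a b), IsVSquare C (φ a) (φ b) (F.map f) (G.map f) }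
  reindex α φ := ⟨fun a => C.reindex α (φ.1 a), fun f => (φ.2 f).reindex_left α⟩
  comp ψ φ := ⟨fun a => C.comp (ψ.1 a) (φ.1 a), fun f => (φ.2 f).comp_left (ψ.2 f)⟩
  ident F := ⟨fun a => C.ident (F.obj a), fun f => IsVSquare.ident_left (F.map f)⟩
  reindex_id φ := Subtype.ext (funext fun a => C.reindex_id _)
  reindex_comp α β φ := Subtype.ext (funext fun a => C.reindex_comp _ _ _)
  comp_reindex β α ψ φ := Subtype.ext (funext fun a => C.comp_reindex _ _ _ _)
  assoc χ ψ φ := Subtype.ext (funext fun a => C.assoc _ _ _)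
  comp_ident φ := Subtype.ext (funext fun a => C.comp_ident _)
  ident_comp φ := Subtype.ext (funext fun a => C.ident_comp _)

/-- A `V`-graded bifunctor `F : A, B → C`: `V`-graded functors `F(-, b) : A → C` and
`F(a, -) : B → C` that agree on objects, such that `(F(f, b), F(f, b'), F(a, g), F(a', g))` is
always a `V`-graded square. Here `mapL b f` is `F(f, b)` and `mapR a g` is `F(a, g)`. -/
structure VGBif (A B C : GradedCat V) where
  obj : A.Obj → B.Obj → C.Obj
  mapL : ∀ (b : B.Obj) {X : V} {a a' : A.Obj}, A.Hom X a a' → C.Hom X (obj a b) (obj a' b)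
  mapR : ∀ (a : A.Obj) {X : V} {b b' : B.Obj}, B.Hom X b b' → C.Hom X (obj a b) (obj a b')
  mapL_reindex : ∀ (b : B.Obj) {X Y : V} {a a' : A.Obj} (α : Y ⟶ X) (f : A.Hom X a a'),
    mapL b (A.reindex α f) = C.reindex α (mapL b f)
  mapL_comp : ∀ (b : B.Obj) {X Y : V} {a a' a'' : A.Obj} (f' : A.Hom Y a' a'') (f : A.Hom X a a'),
    mapL b (A.comp f' f) = C.comp (mapL b f') (mapL b f)
  mapL_ident : ∀ (b : B.Obj) (a : A.Obj), mapL b (A.ident a) = C.ident (obj a b)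
  mapR_reindex : ∀ (a : A.Obj) {X Y : V} {b b' : B.Obj} (β : Y ⟶ X) (g : B.Hom X b b'),
    mapR a (B.reindex β g) = C.reindex β (mapR a g)
  mapR_comp : ∀ (a : A.Obj) {X Y : V} {b b' b'' : B.Obj} (g' : B.Hom Y b' b'') (g : B.Hom X b b'),
    mapR a (B.comp g' g) = C.comp (mapR a g') (mapR a g)
  mapR_ident : ∀ (a : A.Obj) (b : B.Obj), mapR a (B.ident b) = C.ident (obj a b)
  square : ∀ {X X' : V} {a a' : A.Obj} {b b' : B.Obj} (f : A.Hom X a a') (g : B.Hom X' b b'),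
    IsVSquare C (mapL b f) (mapL b' f) (mapR a g) (mapR a' g)

/-- A transformation of `V`-graded bifunctors: a family of morphisms of the underlying ordinary
category that is graded-natural in each variable separately. -/
@[ext]
structure VGBifTrans {A B C : GradedCat V} (F G : VGBif A B C) where
  app : ∀ (a : A.Obj) (b : B.Obj), C.Hom (𝟙_ V) (F.obj a b) (G.obj a b)
  naturalL : ∀ (b : B.Obj) {X : V} {a a' : A.Obj} (f : A.Hom X a a'),
    C.lact (app a' b) (F.mapL b f) = C.ract (G.mapL b f) (app a b)
  naturalR : ∀ (a : A.Obj) {X : V} {b b' : B.Obj} (g : B.Hom X b b'),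
    C.lact (app a b') (F.mapR a g) = C.ract (G.mapR a g) (app a b)

namespace VGBif

variable {A A' B B' C C' : GradedCat V}

/-- The `V`-graded functor `F(-, b) : A → C`. -/
def left (F : VGBif A B C) (b : B.Obj) : GFunctor A C where
  obj a := F.obj a b
  map f := F.mapL b f
  map_reindex := F.mapL_reindex b
  map_comp := F.mapL_comp b
  map_ident := F.mapL_ident b

/-- The `V`-graded functor `F(a, -) : B → C`. -/
def right (F : VGBif A B C) (a : A.Obj) : GFunctor B C where
  obj b := F.obj a b
  map g := F.mapR a g
  map_reindex := F.mapR_reindex a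
  map_comp := F.mapR_comp a
  map_ident := F.mapR_ident a

/-- The `V`-graded bifunctor `(a, b) ↦ R F(P a, Q b)`. -/
def whisker (P : A' ⟶ A) (Q : B' ⟶ B) (R : C ⟶ C') (F : VGBif A B C) : VGBif A' B' C' where
  obj a b := R.obj (F.obj (P.obj a) (Q.obj b))
  mapL b _ _ _ f := R.map (F.mapL (Q.obj b) (P.map f))
  mapR a _ _ _ g := R.map (F.mapR (P.obj a) (Q.map g))
  mapL_reindex b := (GFunctor.comp P (GFunctor.comp (F.left (Q.obj b)) R)).map_reindex
  mapL_comp b := (GFunctor.comp P (GFunctor.comp (F.left (Q.obj b)) R)).map_comp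
  mapL_ident b := (GFunctor.comp P (GFunctor.comp (F.left (Q.obj b)) R)).map_ident
  mapR_reindex a := (GFunctor.comp Q (GFunctor.comp (F.right (P.obj a)) R)).map_reindex
  mapR_comp a := (GFunctor.comp Q (GFunctor.comp (F.right (P.obj a)) R)).map_comp
  mapR_ident a := (GFunctor.comp Q (GFunctor.comp (F.right (P.obj a)) R)).map_ident
  square f g := (F.square (P.map f) (Q.map g)).map R

/-- `V`-graded bifunctors and their transformations form a category. -/
instance : Category.{u} (VGBif A B C) where
  Hom F G := VGBifTrans F G
  id F := ⟨fun a b => C.ident (F.obj a b),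
    fun b _ _ _ f => (lact_ident (F.mapL b f)).trans (ract_ident (F.mapL b f)).symm,
    fun a _ _ _ g => (lact_ident (F.mapR a g)).trans (ract_ident (F.mapR a g)).symm⟩
  comp η θ := ⟨fun a b => C.lact (θ.app a b) (η.app a b),
    fun b _ _ _ f => lact_paste (η.naturalL b f) (θ.naturalL b f),
    fun a _ _ _ g => lact_paste (η.naturalR a g) (θ.naturalR a g)⟩
  id_comp η := VGBifTrans.ext (funext fun a => funext fun b =>
    (lact_eq_ract _ _).trans (ract_ident _))
  comp_id η := VGBifTrans.ext (funext fun a => funext fun b => lact_ident _)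
  assoc η θ κ := VGBifTrans.ext (funext fun a => funext fun b => (lact_lact _ _ _).symm)

/-- The functor `V-GBif(A, B; C) ⥤ V-GBif(A', B'; C')`, `F ↦ R F(P -, Q -)`. -/
def map (P : A' ⟶ A) (Q : B' ⟶ B) (R : C ⟶ C') : VGBif A B C ⥤ VGBif A' B' C' where
  obj F := F.whisker P Q R
  map {F G} θ := VGBifTrans.mk (F := F.whisker P Q R) (G := G.whisker P Q R)
    (fun a b => R.map (θ.app (P.obj a) (Q.obj b)))
    (fun b _ _ _ f => (R.map_lact _ _).symm.trans
      ((congrArg R.map (θ.naturalL (Q.obj b) (P.map f))).trans (R.map_ract _ _)))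
    (fun a _ _ _ g => (R.map_lact _ _).symm.trans
      ((congrArg R.map (θ.naturalR (P.obj a) (Q.map g))).trans (R.map_ract _ _)))
  map_id F := VGBifTrans.ext (funext fun a => funext fun b => R.map_ident _)
  map_comp η θ := VGBifTrans.ext (funext fun a => funext fun b => R.map_lact _ _)

/-- The transformation induced by `π : P ⟶ P'`, `κ : Q ⟶ Q'` and `ρ : R ⟶ R'`. Its component at
`(a, b)` is `ρ_{F(P' a, Q' b)} ∘ R F(P' a, κ_b) ∘ R F(π_a, Q b)`. -/
def map₂ {P P' : A' ⟶ A} {Q Q' : B' ⟶ B} {R R' : C ⟶ C'} (π : P ⟶ P') (κ : Q ⟶ Q')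
    (ρ : R ⟶ R') : map P Q R ⟶ map P' Q' R' where
  app F := VGBifTrans.mk (F := F.whisker P Q R) (G := F.whisker P' Q' R')
    (fun a b => C'.lact (ρ.app (F.obj (P'.obj a) (Q'.obj b)))
      (C'.lact (R.map (F.mapR (P'.obj a) (κ.app b))) (R.map (F.mapL (Q.obj b) (π.app a)))))
    (fun b _ a a' f => lact_paste (lact_paste
      ((R.map_lact _ _).symm.trans ((congrArg R.map
        ((((F.left (Q.obj b)).map_lact _ _).symm.trans
        ((congrArg (F.left (Q.obj b)).map (π.naturality f)).trans
          ((F.left (Q.obj b)).map_ract _ _))))).trans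
        (R.map_ract _ _)))
      ((R.map_lact _ _).symm.trans ((congrArg R.map
        (IsVSquare.unit_right_iff.1 (F.square (P'.map f) (κ.app b)))).trans
        (R.map_ract _ _)))) (ρ.naturality _))
    (fun a _ b b' g => lact_paste (lact_paste
      ((R.map_lact _ _).symm.trans ((congrArg R.map
        (IsVSquare.unit_left_iff.1 (F.square (π.app a) (Q.map g)))).trans
        (R.map_ract _ _)))
      ((R.map_lact _ _).symm.trans ((congrArg R.map
        ((((F.right (P'.obj a)).map_lact _ _).symm.trans
        ((congrArg (F.right (P'.obj a)).map (κ.naturality g)).trans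
          ((F.right (P'.obj a)).map_ract _ _))))).trans
        (R.map_ract _ _)))) (ρ.naturality _))
  naturality F G θ := VGBifTrans.ext (funext fun a => funext fun b =>
    (lact_paste (lact_paste
      ((R.map_lact _ _).symm.trans ((congrArg R.map
        ((lact_eq_ract _ _).trans ((θ.naturalL (Q.obj b) (π.app a)).symm.trans
          (lact_eq_ract _ _)))).trans (R.map_ract _ _)))
      ((R.map_lact _ _).symm.trans ((congrArg R.map
        ((lact_eq_ract _ _).trans ((θ.naturalR (P'.obj a) (κ.app b)).symm.trans
          (lact_eq_ract _ _)))).trans (R.map_ract _ _))))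
      (ρ.naturality _)).trans (lact_eq_ract _ _).symm)

end VGBif

end GradedFunctorCategories

noncomputable section Comparison

open GradedCat Duoidal

variable {V : Type u} [Category.{v} V] [MonoidalCategory V] [StarMonoidal V] [Duoidal V]
  [IsNormal V] {A B C : GradedCat V}

/-- The graded bifunctor `A, B → C_⋆` corresponding to a `V`-graded bifunctor `F : A, B → C`,
obtained by composing the functors `F(-, b)` with `L : C ≅ U_ℓ^*C_⋆` and the functors `F(a, -)`
with `R : C ≅ U_r^*C_⋆`. -/
def VGBif.star (F : VGBif A B C) : GBif A B (starCat C) where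
  obj a b := F.obj a b
  mapL b _ _ _ f := (toStarL C).map (F.mapL b f)
  mapR a _ _ _ g := (toStarR C).map (F.mapR a g)
  mapL_reindex b := (GFunctor.comp (F.left b) (toStarL C)).map_reindex
  mapL_comp b := (GFunctor.comp (F.left b) (toStarL C)).map_comp
  mapL_ident b := (GFunctor.comp (F.left b) (toStarL C)).map_ident
  mapR_reindex a := (GFunctor.comp (F.right a) (toStarR C)).map_reindex
  mapR_comp a := (GFunctor.comp (F.right a) (toStarR C)).map_comp
  mapR_ident a := (GFunctor.comp (F.right a) (toStarR C)).map_ident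
  square f g := IsVSquare.iff_bigraded.2 (F.square f g)

/-- The transformation of graded bifunctors corresponding to a transformation of `V`-graded
bifunctors: its components are reindexed along `μ : I ⋆ I ⟶ I`. -/
def VGBifTrans.star {F G : VGBif A B C} (θ : VGBifTrans F G) :
    SesquiTrans F.star.toSesqui G.star.toSesqui where
  app a b := C.reindex μ (θ.app a b)
  naturalL b X a a' f := by
    have h : ∀ (x y : C.Obj) (t : C.Hom (𝟙_ V) x y),
        (toStarL C).map t = C.reindex μ t := fun x y t =>
      congrArg (C.reindex · t) unitR_unit
    have h₁ := ((toStarL C).map_lact _ _).symm.trans ((congrArg (toStarL C).map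
      (θ.naturalL b f)).trans ((toStarL C).map_ract _ _))
    rw [h, h] at h₁
    exact h₁
  naturalR a X b b' g := by
    have h : ∀ (x y : C.Obj) (t : C.Hom (𝟙_ V) x y),
        (toStarR C).map t = C.reindex μ t := fun x y t =>
      congrArg (C.reindex · t) unitL_unit
    have h₁ := ((toStarR C).map_lact _ _).symm.trans ((congrArg (toStarR C).map
      (θ.naturalR a g)).trans ((toStarR C).map_ract _ _))
    rw [h, h] at h₁
    exact h₁

variable (A B C) in
/-- The functor `V-GBif(A, B; C) ⥤ GBif(A, B; C_⋆)`. -/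
def starBif : VGBif A B C ⥤ GBif A B (starCat C) where
  obj F := F.star
  map θ := VGBifTrans.star θ
  map_id F := SesquiTrans.ext rfl
  map_comp η θ := SesquiTrans.ext (funext fun a => funext fun b => by
    have h := base_lact (starFunctor V) (C := C) (X := 𝟙_ (V × V))
      (VGBifTrans.app θ a b) (C.reindex μ (VGBifTrans.app η a b))
    exact (h.trans (lact_reindex _ _ _)).symm)

end Comparison

noncomputable section TwoFunctorsOfGradedBifunctors

open Bicategory Bicategory.Opposite GradedCat Duoidal

variable (V : Type u) [Category.{v} V] [MonoidalCategory V] [StarMonoidal V] [Duoidal V]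
  [IsNormal V]

/-- The 2-functor `(A, B, C) ↦ V-GBif(A, B; C)`, contravariant in `A` and `B`, covariant in `C`. -/
def vgbif₂ : StrictPseudofunctor ((GradedCat V)ᵒᵖ × (GradedCat V)ᵒᵖ × GradedCat V) Cat.{u, u} :=
  .mk''
  { obj := fun a => Cat.of (VGBif a.1.unop a.2.1.unop a.2.2)
    map := fun f => (VGBif.map f.1.unop f.2.1.unop f.2.2).toCatHom
    map₂ := fun θ => (VGBif.map₂ θ.1.unop2 θ.2.1.unop2 θ.2.2).toCatHom₂
    map₂_id := fun {_ b} f => Cat.Hom₂.ext (NatTrans.ext (funext fun F =>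
      VGBifTrans.ext (funext fun x => funext fun y => by
        change b.2.2.lact (b.2.2.ident _) (b.2.2.lact
          (f.2.2.map ((F.right _).map (GradedCat.ident _ _)))
          (f.2.2.map ((F.left _).map (GradedCat.ident _ _)))) = b.2.2.ident _
        exact (lact_ident _).trans ((congrArg₂ b.2.2.lact
          ((congrArg f.2.2.map ((F.right _).map_ident _)).trans (f.2.2.map_ident _))
          ((congrArg f.2.2.map ((F.left _).map_ident _)).trans
            (f.2.2.map_ident _))).trans (lact_ident _)))))
    map₂_comp := fun {_ b f g h} θ κ => Cat.Hom₂.ext (NatTrans.ext (funext fun F =>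
      VGBifTrans.ext (funext fun x => funext fun y =>
        (congrArg (b.2.2.lact _) (congrArg₂ b.2.2.lact
          ((congrArg f.2.2.map ((F.right _).map_lact _ _)).trans (f.2.2.map_lact _ _))
          ((congrArg f.2.2.map ((F.left _).map_lact _ _)).trans (f.2.2.map_lact _ _)))).trans
        (lact_interchange₃
          ((f.2.2.map_lact _ _).symm.trans ((congrArg f.2.2.map
            ((IsVSquare.unit_right_iff.1 (F.square (κ.1.unop2.app x)
              (θ.2.1.unop2.app y))).trans (lact_eq_ract _ _).symm)).trans (f.2.2.map_lact _ _)))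
          ((θ.2.2.naturality _).trans (lact_eq_ract _ _).symm)
          ((θ.2.2.naturality _).trans (lact_eq_ract _ _).symm)))))
    map_id := fun _ => rfl
    map_comp := fun _ _ => rfl
    map₂_whisker_left := fun f _ _ θ => by
      refine Eq.trans ?_ ((Category.id_comp _).trans (Category.comp_id _)).symm
      exact Cat.Hom₂.ext (NatTrans.ext (funext fun F =>
        VGBifTrans.ext (funext fun x => funext fun y => rfl)))
    map₂_whisker_right := fun θ G => by
      refine Eq.trans ?_ ((Category.id_comp _).trans (Category.comp_id _)).symm
      exact Cat.Hom₂.ext (NatTrans.ext (funext fun F =>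
        VGBifTrans.ext (funext fun x => funext fun y =>
          ((G.2.2.map_lact _ _).trans (congrArg _ (G.2.2.map_lact _ _))).symm))) }

/-- The 2-functor `(A, B, C) ↦ GBif(A, B; C_⋆)`. -/
def starGBif₂ :
    StrictPseudofunctor ((GradedCat V)ᵒᵖ × (GradedCat V)ᵒᵖ × GradedCat V) Cat.{u, u} :=
  (pairing (Bicategory.Prod.fst _ _) (pairing
    ((Bicategory.Prod.snd _ _).comp (Bicategory.Prod.fst _ _))
    (((Bicategory.Prod.snd _ _).comp (Bicategory.Prod.snd _ _)).comp (star₂ V)))).comp (gbif₂ V V)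

/-- The 2-functor `(A, C) ↦ [A, C_⋆]_r`. -/
def starFuncR : StrictPseudofunctor ((GradedCat V)ᵒᵖ × GradedCat V) (GradedCat V) :=
  (pairing (Bicategory.Prod.fst _ _) ((Bicategory.Prod.snd _ _).comp (star₂ V))).comp (bifuncR V V)

/-- The 2-functor `(A, C) ↦ [A, C_⋆]_ℓ`. -/
def starFuncL : StrictPseudofunctor ((GradedCat V)ᵒᵖ × GradedCat V) (GradedCat V) :=
  (pairing (Bicategory.Prod.fst _ _) ((Bicategory.Prod.snd _ _).comp (star₂ V))).comp (bifuncL V V)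

variable {V}

/-- For a 2-functor `H`, the 2-functor `(A, B, C) ↦ GCAT(A, H(B, C))`. -/
def homL₂ (H : StrictPseudofunctor ((GradedCat V)ᵒᵖ × GradedCat V) (GradedCat V)) :
    StrictPseudofunctor ((GradedCat V)ᵒᵖ × (GradedCat V)ᵒᵖ × GradedCat V) Cat.{u, u} :=
  (pairing (Bicategory.Prod.fst _ _) ((Bicategory.Prod.snd _ _).comp H)).comp (hom₂ V)

/-- For a 2-functor `H`, the 2-functor `(A, B, C) ↦ GCAT(B, H(A, C))`. -/
def homR₂ (H : StrictPseudofunctor ((GradedCat V)ᵒᵖ × GradedCat V) (GradedCat V)) :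
    StrictPseudofunctor ((GradedCat V)ᵒᵖ × (GradedCat V)ᵒᵖ × GradedCat V) Cat.{u, u} :=
  (pairing ((Bicategory.Prod.snd _ _).comp (Bicategory.Prod.fst _ _))
    ((pairing (Bicategory.Prod.fst _ _)
      ((Bicategory.Prod.snd _ _).comp (Bicategory.Prod.snd _ _))).comp H)).comp (hom₂ V)

end TwoFunctorsOfGradedBifunctors

end VGraded

open VGraded

/-! Normality makes the comparisons X ⋆ I ≅ X and I ⋆ X ≅ X invertible, so L and R are bijective on
graded morphisms; and σ and τ are built so that a V-graded square in C is exactly a bigraded square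
in C_⋆ on the images of its sides under L and R (`IsVSquare.iff_bigraded`). Hence composing with L
in the first variable and with R in the second identifies V-graded bifunctors into C with graded
bifunctors into C_⋆. The inverse reindexes along the inverse isomorphisms (`fromStarL`, `fromStarR`,
`isVSquare_fromStar`). Components of transformations have grade I, where the two comparisons I ⋆ I →
I both equal μ (`unitR_unit`, `unitL_unit`); so one reindexing along μ serves naturality in both
variables, and `starCat_lact` shows that it respects composition.

The universal properties of [B, C]_ℓ and [A, C]_r are currying. A graded functor from A to [B, C]_ℓ
consists of functors F(a, -) and families F(f, b). The condition on a graded morphism of [B, C]_ℓ is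
the square condition of a bifunctor, and since all operations are componentwise, the functor laws
are those of each F(-, b). When two opposite sides have grade I, a square says that these sides are
graded natural (`IsVSquare.unit_left_iff`, `IsVSquare.unit_right_iff`), which accounts for
transformations. The other variable gives [A, C]_r. The comparison [A, C]_r ≅ [A, C_⋆]_r applies L
to objects and R to morphisms; for ℓ these roles are exchanged, up to the swap of V × V.

Naturality on 1-cells is either definitional (currying) or the fact that graded functors commute
with reindexing (comparison with C_⋆). On 2-cells both sides compose the same pieces, up to
bracketing and, for currying into [A, C]_r, one exchange given by a square. -/

namespace VGraded

/-! ### Extensionality across propositional equalities of 1-cells -/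

section Extensionality

open Bicategory

/-- This has the shape of the field `naturality₂` of `TwoNatIso`. It trades the transports there for
a heterogeneous equality, which can be checked component by component. -/
theorem comp_eqToHom_of_heq {C : Type*} [Category C] {a a' b b' : C} {f : a ⟶ b} {g : a' ⟶ b'}
    (ha : a = a') (hb : b = b') (h : f ≍ g) : f ≫ eqToHom hb = eqToHom ha ≫ g := by
  subst ha hb
  rw [eq_of_heq h, eqToHom_refl, eqToHom_refl, Category.comp_id, Category.id_comp]

theorem cat_hom_ext {A B : Cat} {F G : A ⟶ B} (ho : ∀ X, F.toFunctor.obj X = G.toFunctor.obj X)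
    (hm : ∀ (X Y) (f : X ⟶ Y), F.toFunctor.map f ≍ G.toFunctor.map f) : F = G :=
  Cat.Hom.ext (CategoryTheory.Functor.hext ho hm)

/-- The components stay heterogeneous because equal functors need not have definitionally equal
values. The `trans_hext` lemmas below descend one level further, to components in C, where the
endpoints do agree definitionally in the applications. -/
theorem cat_hom₂_heq {A B : Cat} {F F' G G' : A ⟶ B} {η : F ⟶ G} {θ : F' ⟶ G'} (hF : F = F')
    (hG : G = G') (h : ∀ X, η.toNatTrans.app X ≍ θ.toNatTrans.app X) : η ≍ θ := by
  subst hF hG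
  exact heq_of_eq (Cat.Hom₂.ext (NatTrans.ext (funext fun X => eq_of_heq (h X))))

variable {V W : Type u} [Category.{v} V] [MonoidalCategory V] [Category.{v} W]
  [MonoidalCategory W]

/-- The generated extensionality lemma compares the whole polymorphic family of morphism maps at
once. Here one graded morphism is compared at a time; the laws are propositions and add nothing. -/
theorem GFunctor.hext {C D : GradedCat V} {F G : GFunctor C D} (ho : F.obj = G.obj)
    (hm : ∀ {X : V} {A B : C.Obj} (f : C.Hom X A B), F.map f ≍ G.map f) : F = G := by
  obtain ⟨o, m, _, _, _⟩ := F
  obtain ⟨o', m', _, _, _⟩ := G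
  obtain rfl : o = o' := ho
  obtain rfl : @m = @m' := by
    funext X A B f
    exact eq_of_heq (hm f)
  rfl

theorem GNat.hext {C D : GradedCat V} {F F' G G' : GFunctor C D} {η : GNat F G}
    {θ : GNat F' G'} (hF : F = F') (hG : G = G') (h : ∀ A, η.app A ≍ θ.app A) : η ≍ θ := by
  subst hF hG
  exact heq_of_eq (GNat.ext (funext fun A => eq_of_heq (h A)))

variable {A : GradedCat V} {B : GradedCat W} {C : GradedCat (V × W)}

/-- A bifunctor is determined by its objects and its two partial actions, since the functor laws and
the squares are propositions. -/
theorem GBif.hext {F G : GBif A B C} (ho : F.obj = G.obj)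
    (hL : ∀ (b : B.Obj) {X : V} {a a' : A.Obj} (f : A.Hom X a a'), F.mapL b f ≍ G.mapL b f)
    (hR : ∀ (a : A.Obj) {X : W} {b b' : B.Obj} (g : B.Hom X b b'), F.mapR a g ≍ G.mapR a g) :
    F = G := by
  obtain ⟨⟨o, l, r, _, _, _, _, _, _⟩, _⟩ := F
  obtain ⟨⟨o', l', r', _, _, _, _, _, _⟩, _⟩ := G
  obtain rfl : o = o' := ho
  obtain rfl : @l = @l' := by
    funext b X a a' f
    exact eq_of_heq (hL b f)
  obtain rfl : @r = @r' := by
    funext a X b b' g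
    exact eq_of_heq (hR a g)
  rfl

theorem GBif.trans_hext {F F' G G' : GBif A B C} {η : F ⟶ G} {θ : F' ⟶ G'} (hF : F = F')
    (hG : G = G') (h : ∀ a b, SesquiTrans.app η a b ≍ SesquiTrans.app θ a b) : η ≍ θ := by
  subst hF hG
  exact heq_of_eq (SesquiTrans.ext (funext fun a => funext fun b => eq_of_heq (h a b)))

section

variable [StarMonoidal V] [Duoidal V] [IsNormal V] {A B C : GradedCat V}

theorem VGBif.hext {F G : VGBif A B C} (ho : F.obj = G.obj)
    (hL : ∀ (b : B.Obj) {X : V} {a a' : A.Obj} (f : A.Hom X a a'), F.mapL b f ≍ G.mapL b f)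
    (hR : ∀ (a : A.Obj) {X : V} {b b' : B.Obj} (g : B.Hom X b b'), F.mapR a g ≍ G.mapR a g) :
    F = G := by
  obtain ⟨o, l, r, _, _, _, _, _, _, _⟩ := F
  obtain ⟨o', l', r', _, _, _, _, _, _, _⟩ := G
  obtain rfl : o = o' := ho
  obtain rfl : @l = @l' := by
    funext b X a a' f
    exact eq_of_heq (hL b f)
  obtain rfl : @r = @r' := by
    funext a X b b' g
    exact eq_of_heq (hR a g)
  rfl

theorem VGBif.trans_hext {F F' G G' : VGBif A B C} {η : F ⟶ G} {θ : F' ⟶ G'} (hF : F = F')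
    (hG : G = G') (h : ∀ a b, VGBifTrans.app η a b ≍ VGBifTrans.app θ a b) : η ≍ θ := by
  subst hF hG
  exact heq_of_eq (VGBifTrans.ext (funext fun a => funext fun b => eq_of_heq (h a b)))

end

end Extensionality

/-! ### The 2-functors [-, ?]_r and [-, ?]_ℓ -/

noncomputable section FunctorCategories

open Bicategory Bicategory.Opposite GradedCat

variable {V : Type u} [Category.{v} V] [MonoidalCategory V] {A A' C C' : GradedCat V}

/-- The horizontal composite of π, F and ρ is already a transformation in the 2-category of graded
categories. Its naturality is unfolded here because it is the square condition for a morphism of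
grade I in either functor category. -/
theorem horizontal_naturality {P P' : A' ⟶ A} {R R' : C ⟶ C'} (π : P ⟶ P') (ρ : R ⟶ R')
    (F : GFunctor A C) {X : V} {a b : A'.Obj} (f : A'.Hom X a b) :
    C'.lact (C'.lact (ρ.app (F.obj (P'.obj b))) (R.map (F.map (π.app b))))
        (R.map (F.map (P.map f))) =
      C'.ract (R'.map (F.map (P'.map f)))
        (C'.lact (ρ.app (F.obj (P'.obj a))) (R.map (F.map (π.app a)))) :=
  (homMap₂ π ρ).app F |>.naturality f

theorem horizontal_ident (P : A' ⟶ A) (R : C ⟶ C') (F : GFunctor A C) (a : A'.Obj) :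
    C'.lact (C'.ident _) (R.map (F.map (A.ident (P.obj a)))) = C'.ident _ := by
  rw [lact_ident, F.map_ident, R.map_ident]

/-- The interchange law at one component: naturality of ρ at F(t) moves ρ past R F(t). It gives
preservation of vertical composition in both functor categories. -/
theorem horizontal_comp {R R' R'' : C ⟶ C'} (ρ : R ⟶ R') (ρ' : R' ⟶ R'')
    (F : GFunctor A C) {a₁ a₂ a₃ : A.Obj} (s : A.Hom (𝟙_ V) a₁ a₂) (t : A.Hom (𝟙_ V) a₂ a₃) :
    C'.lact (C'.lact (ρ'.app (F.obj a₃)) (ρ.app (F.obj a₃))) (R.map (F.map (A.lact t s))) =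
      C'.lact (C'.lact (ρ'.app (F.obj a₃)) (R'.map (F.map t)))
        (C'.lact (ρ.app (F.obj a₂)) (R.map (F.map s))) := by
  rw [F.map_lact, GFunctor.map_lact]
  exact lact_interchange (ρ.naturality _)

variable [StarMonoidal V] [Duoidal V] [IsNormal V]

/-- The graded functor `[P, R]_r : F ↦ R F P`, `φ ↦ R φ_P`. -/
def funcMapR (P : A' ⟶ A) (R : C ⟶ C') : funcCatR A C ⟶ funcCatR A' C' where
  obj F := GFunctor.comp P (GFunctor.comp F R)
  map φ := ⟨fun a => R.map (φ.1 (P.obj a)), fun f => (φ.2 (P.map f)).map R⟩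
  map_reindex α φ := Subtype.ext (funext fun a => R.map_reindex _ _)
  map_comp ψ φ := Subtype.ext (funext fun a => R.map_comp _ _)
  map_ident F := Subtype.ext (funext fun a => R.map_ident _)

/-- The graded functor `[P, R]_ℓ : F ↦ R F P`, `φ ↦ R φ_P`. -/
def funcMapL (P : A' ⟶ A) (R : C ⟶ C') : funcCatL A C ⟶ funcCatL A' C' where
  obj F := GFunctor.comp P (GFunctor.comp F R)
  map φ := ⟨fun a => R.map (φ.1 (P.obj a)), fun f => (φ.2 (P.map f)).map R⟩
  map_reindex α φ := Subtype.ext (funext fun a => R.map_reindex _ _)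
  map_comp ψ φ := Subtype.ext (funext fun a => R.map_comp _ _)
  map_ident F := Subtype.ext (funext fun a => R.map_ident _)

/-- The 2-cell `[P, R]_r ⟶ [P', R']_r` induced by `π : P ⟶ P'` and `ρ : R ⟶ R'`; its component
at `F` is the horizontal composite of `π`, `F` and `ρ`. -/
def funcMapR₂ {P P' : A' ⟶ A} {R R' : C ⟶ C'} (π : P ⟶ P') (ρ : R ⟶ R') :
    funcMapR P R ⟶ funcMapR P' R' where
  app F := ⟨fun a => C'.lact (ρ.app (F.obj (P'.obj a))) (R.map (F.map (π.app a))),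
    -- The component at F has grade I, so membership in [A', C']_r is just naturality in a.
    fun f => IsVSquare.unit_right_iff.2 (horizontal_naturality π ρ F f)⟩
  naturality φ := Subtype.ext (funext fun a =>
    -- Here it is π_a that has grade I: the square of φ at π_a lets π_a slide past φ, and naturality
    -- of ρ then does the rest.
    lact_paste ((R.map_lact _ _).symm.trans ((congrArg R.map
      (IsVSquare.unit_left_iff.1 (φ.2 (π.app a)))).trans (R.map_ract _ _))) (ρ.naturality _))

/-- The 2-cell `[P, R]_ℓ ⟶ [P', R']_ℓ` induced by `π : P ⟶ P'` and `ρ : R ⟶ R'`; its component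
at `F` is the horizontal composite of `π`, `F` and `ρ`. -/
def funcMapL₂ {P P' : A' ⟶ A} {R R' : C ⟶ C'} (π : P ⟶ P') (ρ : R ⟶ R') :
    funcMapL P R ⟶ funcMapL P' R' where
  app F := ⟨fun a => C'.lact (ρ.app (F.obj (P'.obj a))) (R.map (F.map (π.app a))),
    fun f => IsVSquare.unit_left_iff.2 (horizontal_naturality π ρ F f)⟩
  naturality φ := Subtype.ext (funext fun a =>
    lact_paste ((R.map_lact _ _).symm.trans ((congrArg R.map
      (IsVSquare.unit_right_iff.1 (φ.2 (π.app a)))).trans (R.map_ract _ _))) (ρ.naturality _))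

variable (V) in
/-- The 2-functor `(A, C) ↦ [A, C]_r`. -/
def funcR₂ : StrictPseudofunctor ((GradedCat V)ᵒᵖ × GradedCat V) (GradedCat V) := .mk''
  { obj := fun a => funcCatR a.1.unop a.2
    map := fun f => funcMapR f.1.unop f.2
    map₂ := fun θ => funcMapR₂ θ.1.unop2 θ.2
    map₂_id := fun f => GNat.ext (funext fun F => Subtype.ext (funext fun x =>
      horizontal_ident f.1.unop f.2 F x))
    map₂_comp := fun {_ _ f _ _} θ κ => GNat.ext (funext fun F => Subtype.ext (funext fun x =>
      horizontal_comp θ.2 κ.2 F _ _))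
    map_id := fun _ => rfl
    map_comp := fun _ _ => rfl
    map₂_whisker_left := fun f _ _ θ => by
      -- The comparison 2-cells in the whiskering axiom are identities, because composites of
      -- 1-cells are preserved definitionally. They are stripped before the components are compared.
      refine Eq.trans ?_ ((Category.id_comp _).trans (Category.comp_id _)).symm
      rfl
    map₂_whisker_right := fun θ G => by
      refine Eq.trans ?_ ((Category.id_comp _).trans (Category.comp_id _)).symm
      exact GNat.ext (funext fun F => Subtype.ext (funext fun x =>
        (GFunctor.map_lact G.2 _ _).symm)) }

variable (V) in
/-- The 2-functor `(A, C) ↦ [A, C]_ℓ`. -/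
def funcL₂ : StrictPseudofunctor ((GradedCat V)ᵒᵖ × GradedCat V) (GradedCat V) := .mk''
  { obj := fun a => funcCatL a.1.unop a.2
    map := fun f => funcMapL f.1.unop f.2
    map₂ := fun θ => funcMapL₂ θ.1.unop2 θ.2
    map₂_id := fun f => GNat.ext (funext fun F => Subtype.ext (funext fun x =>
      horizontal_ident f.1.unop f.2 F x))
    map₂_comp := fun {_ _ f _ _} θ κ => GNat.ext (funext fun F => Subtype.ext (funext fun x =>
      horizontal_comp θ.2 κ.2 F _ _))
    map_id := fun _ => rfl
    map_comp := fun _ _ => rfl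
    map₂_whisker_left := fun f _ _ θ => by
      refine Eq.trans ?_ ((Category.id_comp _).trans (Category.comp_id _)).symm
      rfl
    map₂_whisker_right := fun θ G => by
      refine Eq.trans ?_ ((Category.id_comp _).trans (Category.comp_id _)).symm
      exact GNat.ext (funext fun F => Subtype.ext (funext fun x =>
        (GFunctor.map_lact G.2 _ _).symm)) }

end FunctorCategories

end VGraded

namespace VGraded

/-! ### Currying V-graded bifunctors -/

noncomputable section Currying

open Bicategory Bicategory.Opposite GradedCat

variable {V : Type u} [Category.{v} V] [MonoidalCategory V] [StarMonoidal V] [Duoidal V]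
  [IsNormal V] (A B C : GradedCat V)

/-- The functor `GCAT(A, [B, C]_ℓ) ⥤ V-GBif(A, B; C)`. -/
def uncurryL : (A ⟶ funcCatL B C) ⥤ VGBif A B C where
  obj F :=
    { obj := fun a b => (F.obj a).obj b
      mapL := fun b _ _ _ f => (F.map f).1 b
      mapR := fun a _ _ _ g => (F.obj a).map g
      -- The operations of [B, C]_ℓ are componentwise, so evaluating the laws of F at b yields those
      -- of F(-, b).
      mapL_reindex := fun b _ _ _ _ α f =>
        congrFun (congrArg Subtype.val (F.map_reindex α f)) b
      mapL_comp := fun b _ _ _ _ _ f' f =>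
        congrFun (congrArg Subtype.val (F.map_comp f' f)) b
      mapL_ident := fun b a => congrFun (congrArg Subtype.val (F.map_ident a)) b
      mapR_reindex := fun a => (F.obj a).map_reindex
      mapR_comp := fun a => (F.obj a).map_comp
      mapR_ident := fun a => (F.obj a).map_ident
      -- The bifunctor square is the condition that makes F(f) a graded morphism of [B, C]_ℓ.
      square := fun f g => (F.map f).2 g }
  map θ :=
    { app := fun a b => (θ.app a).1 b
      naturalL := fun b _ _ _ f => congrFun (congrArg Subtype.val (θ.naturality f)) b
      -- Naturality in A is that of θ itself, while naturality in B comes from each θ_a being a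
      -- morphism of grade I in [B, C]_ℓ.
      naturalR := fun a _ _ _ g => IsVSquare.unit_left_iff.1 ((θ.app a).2 g) }
  map_id _ := rfl
  map_comp _ _ := rfl

/-- The functor `V-GBif(A, B; C) ⥤ GCAT(A, [B, C]_ℓ)`. -/
def curryL : VGBif A B C ⥤ (A ⟶ funcCatL B C) where
  obj F :=
    { obj := F.right
      map := fun f => ⟨fun b => F.mapL b f, fun g => F.square f g⟩
      map_reindex := fun α f => Subtype.ext (funext fun b => F.mapL_reindex b α f)
      map_comp := fun f' f => Subtype.ext (funext fun b => F.mapL_comp b f' f)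
      map_ident := fun a => Subtype.ext (funext fun b => F.mapL_ident b a) }
  map θ :=
    { app := fun a => ⟨fun b => θ.app a b,
        fun g => IsVSquare.unit_left_iff.2 (θ.naturalR a g)⟩
      naturality := fun f => Subtype.ext (funext fun b => θ.naturalL b f) }
  map_id _ := rfl
  map_comp _ _ := rfl

/-- The functor `GCAT(B, [A, C]_r) ⥤ V-GBif(A, B; C)`. -/
def uncurryR : (B ⟶ funcCatR A C) ⥤ VGBif A B C where
  obj F :=
    { obj := fun a b => (F.obj b).obj a
      mapL := fun b _ _ _ f => (F.obj b).map f
      mapR := fun a _ _ _ g => (F.map g).1 a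
      mapL_reindex := fun b => (F.obj b).map_reindex
      mapL_comp := fun b => (F.obj b).map_comp
      mapL_ident := fun b => (F.obj b).map_ident
      mapR_reindex := fun a _ _ _ _ β g =>
        congrFun (congrArg Subtype.val (F.map_reindex β g)) a
      mapR_comp := fun a _ _ _ _ _ g' g =>
        congrFun (congrArg Subtype.val (F.map_comp g' g)) a
      mapR_ident := fun a b => congrFun (congrArg Subtype.val (F.map_ident b)) a
      square := fun f g => (F.map g).2 f }
  map θ :=
    { app := fun a b => (θ.app b).1 a
      -- For [A, C]_r the sources of the two naturality conditions are exchanged: here each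
      -- component carries the condition in A.
      naturalL := fun b _ _ _ f => IsVSquare.unit_right_iff.1 ((θ.app b).2 f)
      naturalR := fun a _ _ _ g => congrFun (congrArg Subtype.val (θ.naturality g)) a }
  map_id _ := rfl
  map_comp _ _ := rfl

/-- The functor `V-GBif(A, B; C) ⥤ GCAT(B, [A, C]_r)`. -/
def curryR : VGBif A B C ⥤ (B ⟶ funcCatR A C) where
  obj F :=
    { obj := F.left
      map := fun g => ⟨fun a => F.mapR a g, fun f => F.square f g⟩
      map_reindex := fun β g => Subtype.ext (funext fun a => F.mapR_reindex a β g)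
      map_comp := fun g' g => Subtype.ext (funext fun a => F.mapR_comp a g' g)
      map_ident := fun b => Subtype.ext (funext fun a => F.mapR_ident a b) }
  map θ :=
    { app := fun b => ⟨fun a => θ.app a b,
        fun f => IsVSquare.unit_right_iff.2 (θ.naturalL b f)⟩
      naturality := fun g => Subtype.ext (funext fun a => θ.naturalR a g) }
  map_id _ := rfl
  map_comp _ _ := rfl

variable (V)

/-- The 2-natural isomorphism `GCAT(A, [B, C]_ℓ) ≅ V-GBif(A, B; C)`. -/
def uncurryLIso : TwoNatIso (homL₂ (funcL₂ V)) (vgbif₂ V) where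
  app a := (uncurryL a.1.unop a.2.1.unop a.2.2).toCatHom
  inv a := (curryL a.1.unop a.2.1.unop a.2.2).toCatHom
  -- Currying only regroups data, so it is inverse to uncurrying by eta for structures, and strictly
  -- natural on 1-cells.
  app_inv _ := rfl
  inv_app _ := rfl
  naturality _ := rfl
  naturality₂ θ := comp_eqToHom_of_heq _ _ <| cat_hom₂_heq rfl rfl fun F =>
    -- Both sides compose ρ, R F(P'x, κ_y) and R F(π_x, Qy) in the same order, with different
    -- bracketing.
    VGBif.trans_hext rfl rfl fun x y => heq_of_eq (lact_lact _ _ _)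

/-- The 2-natural isomorphism `V-GBif(A, B; C) ≅ GCAT(B, [A, C]_r)`. -/
def curryRIso : TwoNatIso (vgbif₂ V) (homR₂ (funcR₂ V)) where
  app a := (curryR a.1.unop a.2.1.unop a.2.2).toCatHom
  inv a := (uncurryR a.1.unop a.2.1.unop a.2.2).toCatHom
  app_inv _ := rfl
  inv_app _ := rfl
  naturality _ := rfl
  naturality₂ {a b f g} θ := comp_eqToHom_of_heq _ _ <| cat_hom₂_heq rfl rfl fun F =>
    GNat.hext rfl rfl fun y => heq_of_eq <| Subtype.ext <| funext fun x => by
      -- On the side of [A, C]_r the transformation κ acts before π, whereas the bifunctor action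
      -- has π first. The square of π_x and κ_y, both of grade I, exchanges them.
      have h := (IsVSquare.unit_right_iff.1 (F.square (θ.1.unop2.app x)
        (θ.2.1.unop2.app y))).trans (lact_eq_ract _ _).symm
      have h' := (f.2.2.map_lact _ _).symm.trans ((congrArg f.2.2.map h).trans
        (f.2.2.map_lact _ _))
      exact (congrArg (b.2.2.lact _) h').trans (lact_lact _ _ _).symm

end Currying

end VGraded

namespace VGraded

/-! ### V-graded bifunctors into C and graded bifunctors into C_⋆ -/

noncomputable section StarBifunctors

open Bicategory Bicategory.Opposite GradedCat Duoidal

variable {V : Type u} [Category.{v} V] [MonoidalCategory V]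

/-- This allows the four sides to be replaced separately. Rewriting inside a square in C_⋆ would
have to see through the definitional equality between the grades of C_⋆ and those of C. -/
theorem IsBigradedSquare.of_eq {W : Type u} [Category.{v} W] [MonoidalCategory W]
    {C : GradedCat (V × W)} {X : V} {X' : W} {A A' B B' : C.Obj}
    {f f₁ : C.Hom (X, 𝟙_ W) A A'} {g g₁ : C.Hom (X, 𝟙_ W) B B'}
    {φ φ₁ : C.Hom (𝟙_ V, X') A B} {φ' φ₁' : C.Hom (𝟙_ V, X') A' B'}
    (h : IsBigradedSquare C f g φ φ') (hf : f₁ = f) (hg : g₁ = g) (hφ : φ₁ = φ)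
    (hφ' : φ₁' = φ') : IsBigradedSquare C f₁ g₁ φ₁ φ₁' := by
  subst hf hg hφ hφ'
  exact h

variable [StarMonoidal V] [Duoidal V]

/-- Reindexing along μ takes composites in C_0 to composites in (C_⋆)_0, because μ is the counit
constraint of ⋆. All comparisons of 2-cells with C_⋆ rest on this. -/
theorem starCat_lact {C : GradedCat V} {x y z : C.Obj} (h : C.Hom (𝟙_ V) y z) (f : C.Hom (𝟙_ V) x y) :
    (starCat C).lact (X := 𝟙_ (V × V)) (C.reindex μ h) (C.reindex μ f) =
      C.reindex μ (C.lact h f) :=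
  (base_lact (starFunctor V) (C := C) (X := 𝟙_ (V × V)) h (C.reindex μ f)).trans
    (lact_reindex _ _ _)

variable [IsNormal V]

section

variable {C : GradedCat V} {X : V} {a b : C.Obj}

/-- Normality enters here: the comparison X ⋆ I → X is invertible, so reindexing along it is
injective. -/
theorem toStarL_inj {f g : C.Hom X a b} : (toStarL C).map f = (toStarL C).map g ↔ f = g :=
  reindex_inj (unitR X)

theorem toStarR_inj {f g : C.Hom X a b} : (toStarR C).map f = (toStarR C).map g ↔ f = g :=
  reindex_inj (unitL X)

theorem toStarL_reindex_inv (f : C.Hom (X ⋆ 𝟙_ V) a b) :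
    (toStarL C).map (C.reindex (unitR X).inv f) = f :=
  (reindex_reindex _ _ _).trans
    ((congrArg (C.reindex · f) (unitR X).hom_inv_id).trans (C.reindex_id f))

theorem toStarR_reindex_inv (f : C.Hom (𝟙_ V ⋆ X) a b) :
    (toStarR C).map (C.reindex (unitL X).inv f) = f :=
  (reindex_reindex _ _ _).trans
    ((congrArg (C.reindex · f) (unitL X).hom_inv_id).trans (C.reindex_id f))

theorem reindex_inv_toStarL (f : C.Hom X a b) :
    C.reindex (unitR X).inv ((toStarL C).map f) = f :=
  toStarL_inj.1 (toStarL_reindex_inv _)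

theorem reindex_inv_toStarR (f : C.Hom X a b) :
    C.reindex (unitL X).inv ((toStarR C).map f) = f :=
  toStarR_inj.1 (toStarR_reindex_inv _)

end

variable (V) in
-- Both are μ. So L and R, and likewise their inverses, act in the same way on morphisms of grade I.
theorem unitR_unit_eq_unitL_unit : unitR (𝟙_ V) = unitL (𝟙_ V) :=
  Iso.ext (unitR_unit.trans unitL_unit.symm)

/-- The inverse of `L : C → U_ℓ^*C_⋆`. -/
def fromStarL (C : GradedCat V) : GFunctor (baseObj (Uℓ V V) (starCat C)) C where
  obj a := a
  map {X _ _} f := C.reindex (unitR X).inv f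
  -- The inverse of a graded functor that is bijective on graded morphisms is again one: each law is
  -- tested after applying the injective L, where it becomes the corresponding law of L.
  map_reindex {_ Y _ _} α f := toStarL_inj.1 ((toStarL_reindex_inv (X := Y) _).trans
    (((toStarL C).map_reindex _ _).trans (congrArg _ (toStarL_reindex_inv _))).symm)
  map_comp {X Y _ _ _} g f := toStarL_inj.1 ((toStarL_reindex_inv (X := Y ⊗ X) _).trans
    (((toStarL C).map_comp _ _).trans
      (congrArg₂ _ (toStarL_reindex_inv _) (toStarL_reindex_inv _))).symm)
  map_ident a := toStarL_inj.1 ((toStarL_reindex_inv (X := 𝟙_ V) _).trans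
    ((toStarL C).map_ident a).symm)

/-- The inverse of `R : C → U_r^*C_⋆`. -/
def fromStarR (C : GradedCat V) : GFunctor (baseObj (Ur V V) (starCat C)) C where
  obj a := a
  map {X _ _} f := C.reindex (unitL X).inv f
  map_reindex {_ Y _ _} α f := toStarR_inj.1 ((toStarR_reindex_inv (X := Y) _).trans
    (((toStarR C).map_reindex _ _).trans (congrArg _ (toStarR_reindex_inv _))).symm)
  map_comp {X Y _ _ _} g f := toStarR_inj.1 ((toStarR_reindex_inv (X := Y ⊗ X) _).trans
    (((toStarR C).map_comp _ _).trans
      (congrArg₂ _ (toStarR_reindex_inv _) (toStarR_reindex_inv _))).symm)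
  map_ident a := toStarR_inj.1 ((toStarR_reindex_inv (X := 𝟙_ V) _).trans
    ((toStarR C).map_ident a).symm)

/-- Every side of a bigraded square in C_⋆ is the image under L or R of its reindexing along the
inverse comparison, so `IsVSquare.iff_bigraded` can be read backwards. -/
theorem isVSquare_fromStar {C : GradedCat V} {X X' : V} {a a' b b' : C.Obj}
    {f : (starCat C).Hom (X, 𝟙_ V) a a'} {g : (starCat C).Hom (X, 𝟙_ V) b b'}
    {φ : (starCat C).Hom (𝟙_ V, X') a b} {φ' : (starCat C).Hom (𝟙_ V, X') a' b'}
    (h : IsBigradedSquare (starCat C) f g φ φ') :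
    IsVSquare C ((fromStarL C).map (X := X) f) ((fromStarL C).map (X := X) g)
      ((fromStarR C).map (X := X') φ) ((fromStarR C).map (X := X') φ') := 
  IsVSquare.iff_bigraded.1 (h.of_eq (toStarL_reindex_inv f) (toStarL_reindex_inv g)
    (toStarR_reindex_inv φ) (toStarR_reindex_inv φ'))

variable {A B C : GradedCat V}

/-- The `V`-graded bifunctor `A, B → C` corresponding to a graded bifunctor `A, B → C_⋆`. -/
def GBif.unstar (F : GBif A B (starCat C)) : VGBif A B C where
  obj := F.obj
  mapL b _ _ _ f := (fromStarL C).map (F.mapL b f)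
  mapR a _ _ _ g := (fromStarR C).map (F.mapR a g)
  mapL_reindex b := (GFunctor.comp (F.left b) (fromStarL C)).map_reindex
  mapL_comp b := (GFunctor.comp (F.left b) (fromStarL C)).map_comp
  mapL_ident b := (GFunctor.comp (F.left b) (fromStarL C)).map_ident
  mapR_reindex a := (GFunctor.comp (F.right a) (fromStarR C)).map_reindex
  mapR_comp a := (GFunctor.comp (F.right a) (fromStarR C)).map_comp
  mapR_ident a := (GFunctor.comp (F.right a) (fromStarR C)).map_ident
  square f g := isVSquare_fromStar (F.square f g)

theorem reindex_unitR_unit_inv {a b : C.Obj} (t : C.Hom (𝟙_ V ⋆ 𝟙_ V) a b) :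
    C.reindex (unitR (𝟙_ V)).inv t = C.reindex (unitL (𝟙_ V)).inv t := by
  rw [unitR_unit_eq_unitL_unit]

/-- The transformation of `V`-graded bifunctors corresponding to a transformation of graded
bifunctors valued in `C_⋆`. -/
def SesquiTrans.unstar {F G : GBif A B (starCat C)} (θ : SesquiTrans F.toSesqui G.toSesqui) :
    VGBifTrans F.unstar G.unstar where
  -- This is reindexing along the inverse of μ. The choice of `unitR` over `unitL` makes naturality
  -- in the first variable immediate.
  app a b := C.reindex (unitR (𝟙_ V)).inv (θ.app a b)
  naturalL b _ _ _ f := ((fromStarL C).map_lact _ _).symm.trans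
    ((congrArg (fromStarL C).map (θ.naturalL b f)).trans ((fromStarL C).map_ract _ _))
  naturalR a _ _ _ g := by
    have h := ((fromStarR C).map_lact _ _).symm.trans
      ((congrArg (fromStarR C).map (θ.naturalR a g)).trans ((fromStarR C).map_ract _ _))
    -- Applying the inverse of R yields components reindexed along `unitL`, which agrees with
    -- `unitR` at I.
    exact (congrArg (C.lact · _) (reindex_unitR_unit_inv _)).trans
      (h.trans (congrArg (C.ract _) (reindex_unitR_unit_inv _).symm))

theorem reindex_μ_unit_inv {x y : C.Obj} (f : C.Hom (𝟙_ V ⋆ 𝟙_ V) x y) :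
    C.reindex μ (C.reindex (unitR (𝟙_ V)).inv f) = f := by
  rw [reindex_reindex, ← unitR_unit, Iso.hom_inv_id, C.reindex_id]

theorem reindex_unit_inv_μ {x y : C.Obj} (f : C.Hom (𝟙_ V) x y) :
    C.reindex (unitR (𝟙_ V)).inv (C.reindex μ f) = f := by
  rw [reindex_reindex, ← unitR_unit, Iso.inv_hom_id, C.reindex_id]

variable (A B C) in
/-- The functor `GBif(A, B; C_⋆) ⥤ V-GBif(A, B; C)`. -/
def unstarBif : GBif A B (starCat C) ⥤ VGBif A B C where
  obj F := F.unstar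
  map θ := SesquiTrans.unstar θ
  map_id F := VGBifTrans.ext (funext fun a => funext fun b => reindex_unit_inv_μ _)
  map_comp η θ := VGBifTrans.ext (funext fun a => funext fun b => by
    -- Both factors are written as reindexings along μ, so that `starCat_lact` applies; the outer
    -- reindexing along the inverse of μ then cancels.
    refine (congrArg (C.reindex (unitR (𝟙_ V)).inv) ((congrArg₂ (starCat C).lact
      (reindex_μ_unit_inv (C := C) _).symm (reindex_μ_unit_inv (C := C) _).symm).trans
      (starCat_lact _ _))).trans (reindex_unit_inv_μ _))

theorem unstar_star (F : VGBif A B C) : F.star.unstar = F :=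
  VGBif.hext rfl (fun b _ _ _ f => heq_of_eq (reindex_inv_toStarL _))
    (fun a _ _ _ g => heq_of_eq (reindex_inv_toStarR _))

theorem star_unstar (F : GBif A B (starCat C)) : F.unstar.star = F :=
  GBif.hext rfl (fun b _ _ _ f => heq_of_eq (toStarL_reindex_inv _))
    (fun a _ _ _ g => heq_of_eq (toStarR_reindex_inv _))

/-- Naturality on 1-cells reduces to R commuting with the reindexings that define L and R; P and Q
only change where these are evaluated. -/
theorem star_whisker {A' B' C' : GradedCat V} (P : A' ⟶ A) (Q : B' ⟶ B) (R : C ⟶ C')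
    (F : VGBif A B C) :
    (F.whisker P Q R).star = (GBif.map P Q ((star₂ V).map R)).obj F.star :=
  GBif.hext rfl (fun b _ _ _ f => heq_of_eq (R.map_reindex _ _).symm)
    (fun a _ _ _ g => heq_of_eq (R.map_reindex _ _).symm)

theorem toStarL_unit {x y : C.Obj} (t : C.Hom (𝟙_ V) x y) :
    (toStarL C).map t = C.reindex μ t := congrArg (C.reindex · t) unitR_unit

theorem toStarR_unit {x y : C.Obj} (t : C.Hom (𝟙_ V) x y) :
    (toStarR C).map t = C.reindex μ t := congrArg (C.reindex · t) unitL_unit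

variable (V) in
/-- The 2-natural isomorphism `V-GBif(A, B; C) ≅ GBif(A, B; C_⋆)`. -/
def starBifIso : TwoNatIso (vgbif₂ V) (starGBif₂ V) where
  app a := (starBif a.1.unop a.2.1.unop a.2.2).toCatHom
  inv a := (unstarBif a.1.unop a.2.1.unop a.2.2).toCatHom
  -- The two passages are inverse only propositionally on bifunctors, so the transformations are
  -- compared heterogeneously.
  app_inv a := cat_hom_ext unstar_star fun F G θ =>
    VGBif.trans_hext (unstar_star F) (unstar_star G) fun x y => heq_of_eq (reindex_unit_inv_μ _)
  inv_app a := cat_hom_ext star_unstar fun F G θ =>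
    GBif.trans_hext (star_unstar F) (star_unstar G) fun x y => heq_of_eq (reindex_μ_unit_inv _)
  naturality f := cat_hom_ext (fun F => star_whisker _ _ _ F) fun F G θ =>
    GBif.trans_hext (star_whisker _ _ _ F) (star_whisker _ _ _ G) fun x y =>
      heq_of_eq (f.2.2.map_reindex _ _).symm
  naturality₂ {a b f g} θ := comp_eqToHom_of_heq _ _ <|
    cat_hom₂_heq (cat_hom_ext (fun F => star_whisker _ _ _ F) fun F G θ =>
      GBif.trans_hext (star_whisker _ _ _ F) (star_whisker _ _ _ G) fun x y =>
        heq_of_eq (f.2.2.map_reindex _ _).symm)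
      (cat_hom_ext (fun F => star_whisker _ _ _ F) fun F G θ =>
      GBif.trans_hext (star_whisker _ _ _ F) (star_whisker _ _ _ G) fun x y =>
        heq_of_eq (g.2.2.map_reindex _ _).symm)
      fun F => GBif.trans_hext (star_whisker _ _ _ F) (star_whisker _ _ _ F) fun x y => by
        refine heq_of_eq ?_
        -- Reindexing along μ is distributed over the threefold composite. The factor ρ matches at
        -- once, and the other two match because R and L at grade I are reindexing along μ.
        refine ((starCat_lact _ _).symm.trans (congrArg _ ((starCat_lact _ _).symm.trans
          (congrArg₂ _ ?_ ?_))))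
        · exact (f.2.2.map_reindex _ _).symm.trans (congrArg f.2.2.map (toStarR_unit _).symm)
        · exact (f.2.2.map_reindex _ _).symm.trans (congrArg f.2.2.map (toStarL_unit _).symm)

end StarBifunctors

end VGraded

namespace VGraded

/-! ### Functor categories into C and into C_⋆ -/

noncomputable section StarFunctorCategories

open Bicategory Bicategory.Opposite GradedCat Duoidal

section Symmetry

variable {V W : Type u} [Category.{v} V] [MonoidalCategory V] [Category.{v} W]
  [MonoidalCategory W] (D : GradedCat (V × W))

/-- The isomorphism `U_r^*D → U_ℓ^* symm^*D`. -/
def symmUr : GFunctor (baseObj (Ur V W) D) (baseObj (Uℓ W V) (baseObj (symm V W) D)) where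
  obj a := a
  map f := f
  map_reindex _ _ := rfl
  -- The constraints of the swap are identities, so the two sides differ by one reindexing along an
  -- identity.
  map_comp g f := congrArg (D.reindex _) (D.reindex_id (D.comp g f)).symm
  map_ident a := congrArg (D.reindex _) (D.reindex_id (D.ident a)).symm

/-- The inverse of `symmUr`. -/
def symmUrInv : GFunctor (baseObj (Uℓ W V) (baseObj (symm V W) D)) (baseObj (Ur V W) D) where
  obj a := a
  map f := f
  map_reindex _ _ := rfl
  map_comp g f := congrArg (D.reindex _) (D.reindex_id (D.comp g f))
  map_ident a := congrArg (D.reindex _) (D.reindex_id (D.ident a))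

/-- The isomorphism `U_ℓ^*D → U_r^* symm^*D`. -/
def symmUℓ : GFunctor (baseObj (Uℓ V W) D) (baseObj (Ur W V) (baseObj (symm V W) D)) where
  obj a := a
  map f := f
  map_reindex _ _ := rfl
  map_comp g f := congrArg (D.reindex _) (D.reindex_id (D.comp g f)).symm
  map_ident a := congrArg (D.reindex _) (D.reindex_id (D.ident a)).symm

/-- The inverse of `symmUℓ`. -/
def symmUℓInv : GFunctor (baseObj (Ur W V) (baseObj (symm V W) D)) (baseObj (Uℓ V W) D) where
  obj a := a
  map f := f
  map_reindex _ _ := rfl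
  map_comp g f := congrArg (D.reindex _) (D.reindex_id (D.comp g f))
  map_ident a := congrArg (D.reindex _) (D.reindex_id (D.ident a))

theorem bifuncCatR_hom_hext {A : GradedCat V} {C : GradedCat (V × W)}
    {F F' G G' : (bifuncCatR A C).Obj} {X : W} {φ : (bifuncCatR A C).Hom X F G}
    {ψ : (bifuncCatR A C).Hom X F' G'} (hF : F = F') (hG : G = G')
    (h : ∀ a, φ.1 a ≍ ψ.1 a) : φ ≍ ψ := by
  subst hF hG
  exact heq_of_eq (Subtype.ext (funext fun a => eq_of_heq (h a)))

end Symmetry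

variable {V : Type u} [Category.{v} V] [MonoidalCategory V] [StarMonoidal V] [Duoidal V]
  [IsNormal V]

theorem funcCatR_hom_hext {A C : GradedCat V}
    {F F' G G' : (funcCatR A C).Obj} {X : V} {φ : (funcCatR A C).Hom X F G}
    {ψ : (funcCatR A C).Hom X F' G'} (hF : F = F') (hG : G = G')
    (h : ∀ a, φ.1 a ≍ ψ.1 a) : φ ≍ ψ := by
  subst hF hG
  exact heq_of_eq (Subtype.ext (funext fun a => eq_of_heq (h a)))

theorem funcCatL_hom_hext {A C : GradedCat V}
    {F F' G G' : (funcCatL A C).Obj} {X : V} {φ : (funcCatL A C).Hom X F G}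
    {ψ : (funcCatL A C).Hom X F' G'} (hF : F = F') (hG : G = G')
    (h : ∀ a, φ.1 a ≍ ψ.1 a) : φ ≍ ψ := by
  subst hF hG
  exact heq_of_eq (Subtype.ext (funext fun a => eq_of_heq (h a)))

variable (A C : GradedCat V)

/-- The graded functor `[A, C]_r → [A, C_⋆]_r`. -/
def funcStarR : GFunctor (funcCatR A C) (bifuncCatR A (starCat C)) where
  obj F := GFunctor.comp F (toStarL C)
  -- In [A, C_⋆]_r objects take values in U_ℓ^*C_⋆ and morphisms in U_r^*C_⋆, hence L on functors
  -- and R on families.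
  map φ := ⟨fun a => (toStarR C).map (φ.1 a), fun f => IsVSquare.iff_bigraded.2 (φ.2 f)⟩
  map_reindex α φ := Subtype.ext (funext fun a => (toStarR C).map_reindex α (φ.1 a))
  map_comp ψ φ := Subtype.ext (funext fun a => (toStarR C).map_comp (ψ.1 a) (φ.1 a))
  map_ident F := Subtype.ext (funext fun a => (toStarR C).map_ident (F.obj a))

/-- The inverse of `funcStarR`. -/
def funcUnstarR : GFunctor (bifuncCatR A (starCat C)) (funcCatR A C) where
  obj F := GFunctor.comp F (fromStarL C)
  map φ := ⟨fun a => (fromStarR C).map (φ.1 a), fun f => isVSquare_fromStar (φ.2 f)⟩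
  map_reindex α φ := Subtype.ext (funext fun a => (fromStarR C).map_reindex α (φ.1 a))
  map_comp ψ φ := Subtype.ext (funext fun a => (fromStarR C).map_comp (ψ.1 a) (φ.1 a))
  map_ident F := Subtype.ext (funext fun a => (fromStarR C).map_ident (F.obj a))

/-- The graded functor `[A, C]_ℓ → [A, C_⋆]_ℓ`. -/
def funcStarL : GFunctor (funcCatL A C) (bifuncCatR A (baseObj (symm V V) (starCat C))) where
  -- As `bifuncL` is the r-construction applied to symm^*C_⋆, functors pass through R and then the
  -- swap; dually, families pass through L.
  obj F := GFunctor.comp F (GFunctor.comp (toStarR C) (symmUr (starCat C)))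
  map φ := ⟨fun a => (toStarL C).map (φ.1 a), fun f =>
    IsBigradedSquare.symm_iff.2 (IsVSquare.iff_bigraded.2 (φ.2 f))⟩
  map_reindex α φ := Subtype.ext (funext fun a =>
    (GFunctor.comp (toStarL C) (symmUℓ (starCat C))).map_reindex α (φ.1 a))
  map_comp ψ φ := Subtype.ext (funext fun a =>
    (GFunctor.comp (toStarL C) (symmUℓ (starCat C))).map_comp (ψ.1 a) (φ.1 a))
  map_ident F := Subtype.ext (funext fun a =>
    (GFunctor.comp (toStarL C) (symmUℓ (starCat C))).map_ident (F.obj a))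

/-- The inverse of `funcStarL`. -/
def funcUnstarL : GFunctor (bifuncCatR A (baseObj (symm V V) (starCat C))) (funcCatL A C) where
  obj F := GFunctor.comp F (GFunctor.comp (symmUrInv (starCat C)) (fromStarR C))
  map φ := ⟨fun a => (fromStarL C).map (φ.1 a), fun f =>
    isVSquare_fromStar (IsBigradedSquare.symm_iff.1 (φ.2 f))⟩
  map_reindex α φ := Subtype.ext (funext fun a =>
    (GFunctor.comp (symmUℓInv (starCat C)) (fromStarL C)).map_reindex α (φ.1 a))
  map_comp ψ φ := Subtype.ext (funext fun a =>
    (GFunctor.comp (symmUℓInv (starCat C)) (fromStarL C)).map_comp (ψ.1 a) (φ.1 a))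
  map_ident F := Subtype.ext (funext fun a =>
    (GFunctor.comp (symmUℓInv (starCat C)) (fromStarL C)).map_ident (F.obj a))

variable {A C}

theorem funcUnstarR_funcStarR_obj (F : GFunctor A C) :
    (funcUnstarR A C).obj ((funcStarR A C).obj F) = F :=
  GFunctor.hext rfl fun f => heq_of_eq (reindex_inv_toStarL _)

theorem funcStarR_funcUnstarR_obj (F : GFunctor A (baseObj (Uℓ V V) (starCat C))) :
    (funcStarR A C).obj ((funcUnstarR A C).obj F) = F :=
  GFunctor.hext rfl fun f => heq_of_eq (toStarL_reindex_inv _)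

theorem funcUnstarL_funcStarL_obj (F : GFunctor A C) :
    (funcUnstarL A C).obj ((funcStarL A C).obj F) = F :=
  GFunctor.hext rfl fun f => heq_of_eq (reindex_inv_toStarR _)

theorem funcStarL_funcUnstarL_obj
    (F : GFunctor A (baseObj (Uℓ V V) (baseObj (symm V V) (starCat C)))) :
    (funcStarL A C).obj ((funcUnstarL A C).obj F) = F :=
  GFunctor.hext rfl fun f => heq_of_eq (toStarR_reindex_inv _)

section

variable {A' C' : GradedCat V} (P : A' ⟶ A) (R : C ⟶ C')

/-- Separated from the equality of graded functors below because the morphism part of that equality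
needs it at both source and target. -/
theorem funcStarR_whisker_obj (F : GFunctor A C) :
    (funcStarR A' C').obj ((funcMapR P R).obj F) =
      (bifuncMap P ((star₂ V).map R)).obj ((funcStarR A C).obj F) :=
  GFunctor.hext rfl fun f => heq_of_eq (R.map_reindex _ _).symm

theorem funcStarR_whisker : funcMapR P R ≫ (show funcCatR A' C' ⟶ _ from funcStarR A' C') =
    (show funcCatR A C ⟶ _ from funcStarR A C) ≫ bifuncMap P ((star₂ V).map R) :=
  GFunctor.hext (funext fun F => funcStarR_whisker_obj P R F) fun φ =>
    bifuncCatR_hom_hext (funcStarR_whisker_obj P R _) (funcStarR_whisker_obj P R _) fun a =>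
      heq_of_eq (R.map_reindex _ _).symm

theorem funcStarL_whisker_obj (F : GFunctor A C) :
    (funcStarL A' C').obj ((funcMapL P R).obj F) =
      (bifuncMap P ((changeBase (symm V V)).map ((star₂ V).map R))).obj ((funcStarL A C).obj F) :=
  GFunctor.hext rfl fun f => heq_of_eq (R.map_reindex _ _).symm

theorem funcStarL_whisker : funcMapL P R ≫ (show funcCatL A' C' ⟶ _ from funcStarL A' C') =
    (show funcCatL A C ⟶ _ from funcStarL A C) ≫
      bifuncMap P ((changeBase (symm V V)).map ((star₂ V).map R)) :=
  GFunctor.hext (funext fun F => funcStarL_whisker_obj P R F) fun φ =>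
    bifuncCatR_hom_hext (funcStarL_whisker_obj P R _) (funcStarL_whisker_obj P R _) fun a =>
      heq_of_eq (R.map_reindex _ _).symm

end

variable (V)

/-- The 2-natural isomorphism `[A, C]_r ≅ [A, C_⋆]_r`. -/
def funcStarRIso : TwoNatIso (funcR₂ V) (starFuncR V) where
  app a := funcStarR a.1.unop a.2
  inv a := funcUnstarR a.1.unop a.2
  -- The objects are themselves functors, recovered only propositionally, whereas the components of
  -- φ keep definitionally equal endpoints.
  app_inv a := GFunctor.hext (funext funcUnstarR_funcStarR_obj) fun φ =>
    funcCatR_hom_hext (funcUnstarR_funcStarR_obj _) (funcUnstarR_funcStarR_obj _) fun a =>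
      heq_of_eq (reindex_inv_toStarR _)
  inv_app a := GFunctor.hext (funext funcStarR_funcUnstarR_obj) fun φ =>
    bifuncCatR_hom_hext (funcStarR_funcUnstarR_obj _) (funcStarR_funcUnstarR_obj _) fun a =>
      heq_of_eq (toStarR_reindex_inv _)
  naturality f := funcStarR_whisker f.1.unop f.2
  naturality₂ {a b f g} θ := comp_eqToHom_of_heq _ _ <|
    GNat.hext (funcStarR_whisker f.1.unop f.2) (funcStarR_whisker g.1.unop g.2) fun F =>
      bifuncCatR_hom_hext (funcStarR_whisker_obj _ _ F) (funcStarR_whisker_obj _ _ F) fun x => by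
        -- One side applies R to a whole component of grade I, while the other applies L to its
        -- factor F(π). They agree because both are reindexing along μ at grade I.
        refine heq_of_eq ((toStarR_unit _).trans ((starCat_lact _ _).symm.trans
          (congrArg _ ?_)))
        exact (f.2.map_reindex _ _).symm.trans (congrArg f.2.map (toStarL_unit _).symm)

/-- The 2-natural isomorphism `[A, C]_ℓ ≅ [A, C_⋆]_ℓ`. -/
def funcStarLIso : TwoNatIso (funcL₂ V) (starFuncL V) where
  app a := funcStarL a.1.unop a.2
  inv a := funcUnstarL a.1.unop a.2
  app_inv a := GFunctor.hext (funext funcUnstarL_funcStarL_obj) fun φ =>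
    funcCatL_hom_hext (funcUnstarL_funcStarL_obj _) (funcUnstarL_funcStarL_obj _) fun a =>
      heq_of_eq (reindex_inv_toStarL _)
  inv_app a := GFunctor.hext (funext funcStarL_funcUnstarL_obj) fun φ =>
    bifuncCatR_hom_hext (funcStarL_funcUnstarL_obj _) (funcStarL_funcUnstarL_obj _) fun a =>
      heq_of_eq (toStarL_reindex_inv _)
  naturality f := funcStarL_whisker f.1.unop f.2
  naturality₂ {a b f g} θ := comp_eqToHom_of_heq _ _ <|
    GNat.hext (funcStarL_whisker f.1.unop f.2) (funcStarL_whisker g.1.unop g.2) fun F =>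
      bifuncCatR_hom_hext (funcStarL_whisker_obj _ _ F) (funcStarL_whisker_obj _ _ F) fun x => by
        refine heq_of_eq ((toStarL_unit _).trans ((starCat_lact _ _).symm.trans
          -- The target composes in symm^*C_⋆. `base_lact` for the swap replaces this by composition
          -- in C_⋆, absorbing the identity reindexing on the component of ρ.
          (Eq.trans (congrArg _ ?_) (base_lact (symm V V) (C := starCat b.2)
            (X := 𝟙_ (V × V)) _ _).symm)))
        exact (f.2.map_reindex _ _).symm.trans (congrArg f.2.map (toStarR_unit _).symm)

end StarFunctorCategories

end VGraded

/-! ### Assembly of the theorem -/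

theorem mainTheorem8 {V : Type u} [Category.{v} V] [MonoidalCategory V] [StarMonoidal V]
    [Duoidal V] [IsNormal V] :
    (∃ Φ : TwoNatIso (vgbif₂ V) (starGBif₂ V), ∀ A B C : GradedCat V,
      (Φ.app (op A, op B, C)).toFunctor = starBif A B C) ∧
    ∃ Hr Hl : StrictPseudofunctor ((GradedCat V)ᵒᵖ × GradedCat V) (GradedCat V),
      (∀ A C : GradedCat V, Hr.obj (op A, C) = funcCatR A C) ∧
      (∀ A C : GradedCat V, Hl.obj (op A, C) = funcCatL A C) ∧
      Nonempty (TwoNatIso (homL₂ Hl) (vgbif₂ V)) ∧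
      Nonempty (TwoNatIso (vgbif₂ V) (homR₂ Hr)) ∧
      Nonempty (TwoNatIso Hr (starFuncR V)) ∧
      Nonempty (TwoNatIso Hl (starFuncL V)) :=
  -- The explicit descriptions hold by definition: the isomorphism was built from `starBif`, and the
  -- 2-functors from `funcCatR` and `funcCatL`.
  ⟨⟨starBifIso V, fun _ _ _ => rfl⟩, funcR₂ V, funcL₂ V, fun _ _ => rfl, fun _ _ => rfl,
    ⟨uncurryLIso V⟩, ⟨curryRIso V⟩, ⟨funcStarRIso V⟩, ⟨funcStarLIso V⟩⟩
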